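/- Let $(X,d)$ be a nonempty compact metric space, let $f\colon X\to X$ be continuous, and let $\mathcal D$ be one of the following distances on the set of Borel probability measures on $X$: a Wasserstein distance $$W_p(\mu,\nu)=\inf_{\pi}\Big(\int_{X\times X} d(x,y)^p\,d\pi(x,y)\Big)^{1/p},\qquad 1\le p<\infty,$$ where $\pi$ runs over the probability measures on $X\times X$ with marginals $\mu$ and $\nu$, or the Lévy–Prokhorov distance. Put $\log\log 1=0$. The topological emergence of $f$ is $$\mathcal E_{\mathrm{top}}(f)=\limsup_{\varepsilon\to0^+}\frac{\log\log S(\varepsilon)}{-\log\varepsilon}\in[0,\infty],$$ where $S(\varepsilon)$ is the maximal cardinality of a set of $f$-invariant ergodic Borel probability measures whose pairwise $\mathcal D$-distances are at least $\varepsilon$. For a Borel probability measure $\mu$ on $X$ and $\varepsilon>0$, let $\mathcal E_\mu(f)(\varepsilon)$ be the minimal $N$ for which there are Borel probability measures $\mu_1,\dots,\mu_N$ on $X$ with $$\limsup_{n\to\infty}\int_X\min_{1\le i\le N}\mathcal D\Big(\frac1n\sum_{j=0}^{n-1}\delta_{f^j(x)},\,\mu_i\Big)\,d\mu(x)\le\varepsilon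 ,$$ and let the metric emergence of $\mu$ be $$\mathcal E_\mu(f)=\limsup_{\varepsilon\to0^+}\frac{\log\log\mathcal E_\mu(f)(\varepsilon)}{-\log\varepsilon}.$$ Then for every $\beta$ with $0\le\beta\le\mathcal E_{\mathrm{top}}(f)$ (including $\beta=\infty$ if $\mathcal E_{\mathrm{top}}(f)=\infty$) there is an $f$-invariant Borel probability measure $\mu$ on $X$ such that $\mathcal E_\mu(f)=\beta$. -/

import Mathlib

open MeasureTheory Filter Topology
open scoped ENNReal

noncomputable section

namespace Emergence

/-- The Wasserstein distance `W_p` between two measures on a metric space, with values in `[0, ∞]`: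
the infimum over all couplings `π` of `(∫ d(x,y)^p dπ)^(1/p)`. (Any coupling of two probability
measures is itself a probability measure.) -/
def wassersteinEDist {X : Type*} [MetricSpace X] [MeasurableSpace X]
    (p : ℝ) (μ ν : Measure X) : ℝ≥0∞ :=
  ⨅ (π : Measure (X × X)) (_ : π.map Prod.fst = μ ∧ π.map Prod.snd = ν),
    (∫⁻ z, (edist z.1 z.2) ^ p ∂π) ^ (1 / p)

/-- `D` is one of the distances in use on the space of Borel probability measures: a Wasserstein
distance `W_p` with `1 ≤ p < ∞`, or the Lévy-Prokhorov distance. -/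
def IsWassersteinOrLevyProkhorov {X : Type*} [MetricSpace X] [MeasurableSpace X]
    (D : Measure X → Measure X → ℝ≥0∞) : Prop :=
  (∃ p : ℝ, 1 ≤ p ∧ D = wassersteinEDist p) ∨ D = levyProkhorovEDist

/-- `log log n`, with the conventions `log log 1 = 0` and `log log ∞ = ∞`.
The value at `1` is the stated one because `Real.log 0 = 0`. -/
def logLog : ℕ∞ → EReal
  | ⊤ => ⊤
  | (n : ℕ) => ((Real.log (Real.log (n : ℝ)) : ℝ) : EReal)

/-- The growth order `limsup_{ε → 0⁺} (log log N(ε)) / (-log ε)` of a counting function `N`. -/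
def upperOrder (N : ℝ → ℕ∞) : EReal :=
  limsup (fun ε : ℝ => logLog (N ε) / ((-Real.log ε : ℝ) : EReal)) (𝓝[>] 0)

/-- The maximal cardinality of an `ε`-separated subset of `S`, for the distance `D`. -/
def separatedNumber {M : Type*} (D : M → M → ℝ≥0∞) (S : Set M) (ε : ℝ) : ℕ∞ :=
  ⨆ (F : Set M) (_ : F ⊆ S ∧ F.Pairwise fun a b => ENNReal.ofReal ε ≤ D a b), F.encard

/-- The upper metric order of a set `S`, for the distance `D`. -/
def upperMetricOrder {M : Type*} (D : M → M → ℝ≥0∞) (S : Set M) : EReal :=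
  upperOrder (separatedNumber D S)

/-- The set of Borel probability measures that are invariant and ergodic under `f`. -/
def ergodicMeasures {X : Type*} [MeasurableSpace X] (f : X → X) : Set (Measure X) :=
  {μ | IsProbabilityMeasure μ ∧ Ergodic f μ}

/-- The topological emergence of `f`: the upper metric order of the set of its ergodic
probability measures. -/
def topologicalEmergence {X : Type*} [MeasurableSpace X]
    (D : Measure X → Measure X → ℝ≥0∞) (f : X → X) : EReal :=
  upperMetricOrder D (ergodicMeasures f)

/-- The empirical measure `(1/n) ∑_{i < n} δ_{f^i(x)}` (meaningful for `n ≥ 1`). -/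
def empiricalMeasure {X : Type*} [MeasurableSpace X] (f : X → X) (n : ℕ) (x : X) : Measure X :=
  (n : ℝ≥0∞)⁻¹ • ∑ i ∈ Finset.range n, Measure.dirac (f^[i] x)

/-- The metric emergence map of `μ`: the minimal number `N` of probability measures
`m_1, …, m_N` with `limsup_n ∫ min_i D(e_n(x), m_i) dμ(x) ≤ ε`. (For `N = 0` the minimum is `∞`,
so no `N = 0` is admissible.) -/
def metricEmergenceMap {X : Type*} [MeasurableSpace X]
    (D : Measure X → Measure X → ℝ≥0∞) (f : X → X) (μ : Measure X) (ε : ℝ) : ℕ∞ :=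
  ⨅ (N : ℕ) (_ : ∃ m : Fin N → ProbabilityMeasure X,
      limsup (fun n : ℕ => ∫⁻ x, ⨅ i, D (empiricalMeasure f n x) (m i : Measure X) ∂μ) atTop
        ≤ ENNReal.ofReal ε), (N : ℕ∞)

/-- The metric emergence of `μ`. -/
def metricEmergence {X : Type*} [MeasurableSpace X]
    (D : Measure X → Measure X → ℝ≥0∞) (f : X → X) (μ : Measure X) : EReal :=
  upperOrder (metricEmergenceMap D f μ)

end Emergence

end

set_option linter.unusedSectionVars false

namespace Emergence

/-! For `β = 0` any ergodic measure works: its empirical measures approach it on average, so one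
measure suffices at every scale.

For `β > 0` the measure is `superposition F`, which gives weight `2 ^ (-(k + 1))` to the uniform
average over a finite set `F k` of ergodic measures. By the mean ergodic theorem, the mean distance
of the empirical measures to finitely many measures `m i` tends to the weighted mean of the
distances of the points of `F k` to these `m i` (`IsPartitionDist.tendsto_lintegral_superposition`).
Emergence thus becomes a covering problem for the sets `F k`.

Lower bound: `F k` is `r k`-separated and has more than `exp (r k ^ (-b k))` points, with `b k → β`.
Fewer than half as many measures leave half of `F k` at distance at least `r k / 2`, which costs a
multiple of `2 ^ (-k) * r k`. As `r k` is far smaller than `2 ^ (-k)`, the weight does not affect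
the order.

Upper bound: `F k` must not be rich at other scales, and few of the `F k` may matter at a given
scale. The first comes from minimality (`exists_sep_subset`): in a minimal set that beats `exp (r ^
(-b))` at some scale `r`, an `ε`-separated subset with more than `exp (ε ^ (-b)) + 1` points would,
minus a point, be a smaller such set. The second comes from localization: growth passes to a piece
of a finite cover (`HasGrowth.biUnion`), so the `F k` can be taken in nested sets of rapidly
shrinking diameter. At scale `ε` about `1 / ε` of them need their own nets, and one point serves all
the others.

The distance enters only through `IsPartitionDist`: closeness on a finite partition forces closeness
for `D`. This turns convergence of visit frequencies into convergence for `D` without any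
measurability of `D`. -/

/-- The growth of a polynomial factor and of a constant is absorbed by a larger exponent. -/
lemma eventually_mul_exp_rpow_le {b c : ℝ} (hb : 0 ≤ b) (hbc : b < c) :
    ∀ᶠ ε : ℝ in 𝓝[>] 0,
      1 + (1 / ε + 2) * (Real.exp (ε ^ (-b)) + 1) ≤ Real.exp (ε ^ (-c)) := by
  have hδ : 0 < c - b := sub_pos.2 hbc
  -- With `t = 1 / ε ≥ 1` and `E = exp (t ^ b) ≥ 1`, the left side is at most `1 + 3 * t * (2 * E) ≤
  -- 7 * t * E`; the factor `exp 1` pays for the `-1` in the exponent below.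
  have key : ∀ᶠ t : ℝ in atTop, (7 * Real.exp 1) * t ≤ Real.exp (t ^ (c - b)) := by
    have h := (tendsto_exp_div_rpow_atTop (1 / (c - b))).comp (tendsto_rpow_atTop hδ)
    filter_upwards [h.eventually_ge_atTop (7 * Real.exp 1), eventually_gt_atTop 0] with t ht ht0
    simp only [Function.comp_apply] at ht
    rw [← Real.rpow_mul ht0.le, mul_one_div_cancel hδ.ne', Real.rpow_one, le_div_iff₀ ht0] at ht
    exact ht
  have key' := (key.and (eventually_ge_atTop 1))
  filter_upwards [tendsto_inv_nhdsGT_zero.eventually key', self_mem_nhdsWithin] with ε hε hε0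
  have hε0' : (0 : ℝ) < ε := hε0
  obtain ⟨h1, h2⟩ := hε
  set t := ε⁻¹ with ht
  have ht0 : 0 < t := inv_pos.2 hε0'
  have e1 : ε ^ (-b) = t ^ b := by rw [ht, Real.inv_rpow hε0'.le, Real.rpow_neg hε0'.le]
  have e2 : ε ^ (-c) = t ^ c := by rw [ht, Real.inv_rpow hε0'.le, Real.rpow_neg hε0'.le]
  have e3 : t ^ c = t ^ b * t ^ (c - b) := by rw [← Real.rpow_add ht0]; congr 1; ring
  have h3 : 1 ≤ t ^ b := Real.one_le_rpow h2 hb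
  have h4 : 1 ≤ t ^ (c - b) := Real.one_le_rpow h2 hδ.le
  -- This is `(t ^ b - 1) * (t ^ (c - b) - 1) ≥ 0`.
  have h5 : t ^ b + (t ^ (c - b) - 1) ≤ t ^ c := by
    rw [e3]; nlinarith
  have h6 : 7 * t ≤ Real.exp (t ^ (c - b) - 1) := by
    rw [Real.exp_sub, le_div_iff₀ (Real.exp_pos 1)]; linarith
  have h7 : 1 ≤ Real.exp (t ^ b) := Real.one_le_exp (by linarith)
  rw [e1, e2, one_div, ← ht]
  calc 1 + (t + 2) * (Real.exp (t ^ b) + 1) ≤ Real.exp (t ^ b) * (7 * t) := by nlinarith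
    _ ≤ Real.exp (t ^ b) * Real.exp (t ^ (c - b) - 1) := by gcongr
    _ = Real.exp (t ^ b + (t ^ (c - b) - 1)) := (Real.exp_add _ _).symm
    _ ≤ Real.exp (t ^ c) := Real.exp_le_exp.2 h5

lemma rpow_neg_le_rpow_neg {ε b c : ℝ} (h0 : 0 < ε) (h1 : ε ≤ 1) (hbc : b ≤ c) :
    ε ^ (-b) ≤ ε ^ (-c) :=
  Real.rpow_le_rpow_of_exponent_ge h0 h1 (neg_le_neg hbc)

/-! ### Separated finite sets and growth order -/

section Separated

variable {M : Type*} {d : M → M → ℝ≥0∞}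

/-- The points of the finite set `G` are `ε`-separated for `d`. -/
def IsSep (d : M → M → ℝ≥0∞) (G : Finset M) (ε : ℝ) : Prop :=
  (G : Set M).Pairwise fun a b => ENNReal.ofReal ε ≤ d a b

lemma IsSep.mono {G H : Finset M} {ε : ℝ} (h : IsSep d G ε) (hH : H ⊆ G) : IsSep d H ε :=
  Set.Pairwise.mono (Finset.coe_subset.2 hH) h

/-- The set `A` has upper metric order at least `β`. -/
def HasGrowth (d : M → M → ℝ≥0∞) (A : Set M) (β : EReal) : Prop :=
  ∀ b : ℝ, 0 < b → (b : EReal) < β → ∃ᶠ ε : ℝ in 𝓝[>] 0, ∃ G : Finset M,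
    (G : Set M) ⊆ A ∧ IsSep d G ε ∧ Real.exp (ε ^ (-b)) < G.card

lemma eventually_lt_one : ∀ᶠ ε : ℝ in 𝓝[>] 0, 0 < ε ∧ ε < 1 := Ioo_mem_nhdsGT one_pos

/-- If both pieces fail, with exponents `b₁` and `b₂`, then at all small scales a separated set has
at most `2 * exp (ε ^ (-max b₁ b₂))` points, which is below `exp (ε ^ (-c))` for any larger `c`. -/
lemma HasGrowth.union {A B : Set M} {β : EReal} (h : HasGrowth d (A ∪ B) β) :
    HasGrowth d A β ∨ HasGrowth d B β := by
  classical
  by_contra! hcon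
  simp only [HasGrowth, not_forall, not_frequently] at hcon
  obtain ⟨⟨b₁, hb₁, hbβ₁, h₁⟩, ⟨b₂, hb₂, hbβ₂, h₂⟩⟩ := hcon
  have hmax : ((max b₁ b₂ : ℝ) : EReal) < β := by
    rcases max_choice b₁ b₂ with h | h <;> rw [h] <;> assumption
  obtain ⟨c, hc1, hc2⟩ := EReal.lt_iff_exists_real_btwn.1 hmax
  have hc1' : max b₁ b₂ < c := by exact_mod_cast hc1
  have hb0 : 0 ≤ max b₁ b₂ := le_max_of_le_left hb₁.le
  refine h c (by linarith) hc2 ?_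
  filter_upwards [h₁, h₂, eventually_lt_one, eventually_mul_exp_rpow_le hb0 hc1']
    with ε e₁ e₂ ⟨hε0, hε1⟩ hexp
  rintro ⟨G, hGA, hG, hcard⟩
  push Not at e₁ e₂
  have k₁ := e₁ (G.filter (· ∈ A)) (by intro x; simp) (hG.mono (Finset.filter_subset _ _))
  have k₂ := e₂ (G.filter (· ∉ A)) (by
    intro x hx
    simp only [Finset.coe_filter, Set.mem_ofPred_eq] at hx
    exact (hGA hx.1).resolve_left hx.2) (hG.mono (Finset.filter_subset _ _))
  have k₃ : (G.card : ℝ) = (G.filter (· ∈ A)).card + (G.filter (· ∉ A)).card := by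
    exact_mod_cast (Finset.card_filter_add_card_filter_not (s := G) (· ∈ A)).symm
  have l₁ := Real.exp_le_exp.2 (rpow_neg_le_rpow_neg hε0 hε1.le (le_max_left b₁ b₂))
  have l₂ := Real.exp_le_exp.2 (rpow_neg_le_rpow_neg hε0 hε1.le (le_max_right b₁ b₂))
  have l₃ : 0 < 1 / ε := by positivity
  have l₄ := Real.exp_pos (ε ^ (-max b₁ b₂))
  nlinarith

/-- The exponent `b` excludes `β ≤ 0`, where growth is an empty condition and an empty union would
be a counterexample. -/
lemma HasGrowth.biUnion {ι : Type*} {β : EReal} {b : ℝ} (hb : 0 < b) (hbβ : (b : EReal) < β)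
    (t : Finset ι) (A : ι → Set M)
    (h : HasGrowth d (⋃ i ∈ t, A i) β) : ∃ i ∈ t, HasGrowth d (A i) β := by
  classical
  induction t using Finset.induction_on with
  | empty =>
    obtain ⟨ε, G, hG, -, hc⟩ := (h b hb hbβ).exists
    have : G = ∅ := by simpa using hG
    subst this
    exact absurd hc (by simp [(Real.exp_pos _).le])
  | insert a s ha ih =>
    rw [Finset.set_biUnion_insert] at h
    rcases h.union with h | h
    · exact ⟨a, by simp, h⟩
    · obtain ⟨i, hi, h⟩ := ih h
      exact ⟨i, by simp [hi], h⟩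

/-- Minimal sets with too many points at some scale: they are separated at that scale, and their
separated subsets at all the other scales are under control. -/
lemma exists_sep_subset {G : Finset M} {b ε₀ : ℝ} (hε₀ : 0 < ε₀) (hG : IsSep d G ε₀)
    (hcard : Real.exp (ε₀ ^ (-b)) < G.card) :
    ∃ F ⊆ G, ∃ r : ℝ, 0 < r ∧ IsSep d F r ∧ Real.exp (r ^ (-b)) < F.card ∧
      ∀ ε : ℝ, 0 < ε → ∀ T ⊆ F, IsSep d T ε → (T.card : ℝ) ≤ Real.exp (ε ^ (-b)) + 1 := by
  classical
  let P : Finset M → Prop := fun F =>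
    F ⊆ G ∧ ∃ r : ℝ, 0 < r ∧ IsSep d F r ∧ Real.exp (r ^ (-b)) < F.card
  have hP : ∃ F, P F := ⟨G, subset_rfl, ε₀, hε₀, hG, hcard⟩
  -- The scale `r` is not fixed in `P`, so minimality of `F` constrains its subsets at all scales at
  -- once.
  obtain ⟨F, hF⟩ := exists_minimal_of_wellFoundedLT P hP
  obtain ⟨hFG, r, hr, hsep, hc⟩ := hF.prop
  refine ⟨F, hFG, r, hr, hsep, hc, fun ε hε T hT hTs => ?_⟩
  rcases T.eq_empty_or_nonempty with rfl | ⟨x, hx⟩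
  · simp; positivity
  by_contra! hcon
  have hlt : T.erase x ⊂ F := (Finset.erase_ssubset hx).trans_subset hT
  have hcardT : ((T.erase x).card : ℝ) = T.card - 1 := by
    rw [Finset.card_erase_of_mem hx, Nat.cast_sub (Finset.card_pos.2 ⟨x, hx⟩)]; simp
  refine hF.not_prop_of_lt hlt ⟨hlt.subset.trans hFG, ε, hε, hTs.mono (Finset.erase_subset _ _), ?_⟩
  rw [hcardT]; linarith

/-- A maximal separated subset is a net. -/
lemma exists_sep_net (F : Finset M) (ε : ℝ) (hself : ∀ x ∈ F, d x x ≤ ENNReal.ofReal ε)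
    (hsymm : ∀ x ∈ F, ∀ y ∈ F, d x y = d y x) :
    ∃ T ⊆ F, IsSep d T ε ∧ ∀ x ∈ F, ∃ y ∈ T, d x y ≤ ENNReal.ofReal ε := by
  classical
  let P : Finset M → Prop := fun T => T ⊆ F ∧ IsSep d T ε
  have hfin : {T | P T}.Finite := F.powerset.finite_toSet.subset fun T hT => by
    simpa using hT.1
  obtain ⟨T, hT⟩ := hfin.exists_maximal ⟨∅, by simp [P, IsSep]⟩
  refine ⟨T, hT.prop.1, hT.prop.2, fun x hx => ?_⟩
  by_contra! hcon
  have hxT : x ∉ T := fun h => (hcon x h).not_ge (hself x hx)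
  refine hT.not_prop_of_gt (Finset.ssubset_insert hxT) ⟨?_, ?_⟩
  · exact Finset.insert_subset hx hT.prop.1
  · unfold IsSep
    rw [Finset.coe_insert, Set.pairwise_insert]
    refine ⟨hT.prop.2, fun y hy _ => ⟨(hcon y hy).le, ?_⟩⟩
    rw [← hsymm x hx y (hT.prop.1 hy)]
    exact (hcon y hy).le

end Separated

/-! ### Comparing `logLog` with the counts `exp (ε ^ (-b))` -/

section LogLog

variable {ε b : ℝ}

lemma log_rpow_neg (h0 : 0 < ε) : Real.log (ε ^ (-b)) = b * -Real.log ε := by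
  rw [Real.log_rpow h0]; ring

lemma neg_log_pos (h0 : 0 < ε) (h1 : ε < 1) : 0 < -Real.log ε :=
  neg_pos.2 (Real.log_neg h0 h1)

lemma log_log_natCast_of_log_nonpos {n : ℕ} (h : Real.log n ≤ 0) : Real.log (Real.log n) = 0 := by
  rw [le_antisymm h (Real.log_natCast_nonneg n), Real.log_zero]

lemma logLog_div_le (h0 : 0 < ε) (h1 : ε < 1) (hb : 0 ≤ b) {n : ℕ}
    (hn : (n : ℝ) ≤ Real.exp (ε ^ (-b))) :
    logLog n / ((-Real.log ε : ℝ) : EReal) ≤ b := by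
  have hl := neg_log_pos h0 h1
  rw [EReal.div_le_iff_le_mul (by exact_mod_cast hl) (EReal.coe_ne_top _), ← EReal.coe_mul]
  change ((Real.log (Real.log n) : ℝ) : EReal) ≤ _
  rw [EReal.coe_le_coe_iff]
  rcases le_or_gt (Real.log n) 0 with h | h
  · rw [log_log_natCast_of_log_nonpos h]; positivity
  · have hn0 : (0 : ℝ) < n := by
      by_contra! hcon
      have : (n : ℝ) = 0 := le_antisymm hcon (Nat.cast_nonneg _)
      simp [this] at h
    have h2 : Real.log n ≤ ε ^ (-b) := (Real.log_le_iff_le_exp hn0).2 hn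
    calc Real.log (Real.log n) ≤ Real.log (ε ^ (-b)) := Real.log_le_log h h2
      _ = _ := by rw [log_rpow_neg h0, mul_comm]

lemma le_logLog_div (h0 : 0 < ε) (h1 : ε < 1) {N : ℕ∞}
    (hN : ∀ n : ℕ, N = n → Real.exp (ε ^ (-b)) ≤ n) :
    (b : EReal) ≤ logLog N / ((-Real.log ε : ℝ) : EReal) := by
  have hl := neg_log_pos h0 h1
  rw [EReal.le_div_iff_mul_le (by exact_mod_cast hl) (EReal.coe_ne_top _), ← EReal.coe_mul]
  induction N using ENat.recTopCoe with
  | top => exact le_top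
  | coe n =>
    change _ ≤ ((Real.log (Real.log n) : ℝ) : EReal)
    rw [EReal.coe_le_coe_iff, ← log_rpow_neg h0]
    have hn := hN n rfl
    have hpos : 0 < ε ^ (-b) := Real.rpow_pos_of_pos h0 _
    refine Real.log_le_log hpos ?_
    rwa [Real.le_log_iff_exp_le ((Real.exp_pos _).trans_le hn)]

lemma exp_lt_of_lt_logLog_div (h0 : 0 < ε) (h1 : ε < 1) (hb : 0 ≤ b) {n : ℕ}
    (hN : (b : EReal) < logLog n / ((-Real.log ε : ℝ) : EReal)) :
    Real.exp (ε ^ (-b)) < n := by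
  by_contra! hcon
  exact (logLog_div_le h0 h1 hb hcon).not_gt hN

end LogLog

/-! ### Localization and the choice of the finite sets -/

section Separated

variable {M : Type*} {d : M → M → ℝ≥0∞} {E : Set M}

lemma hasGrowth_of_le_upperMetricOrder {β : EReal} (hβ : β ≤ upperMetricOrder d E) :
    HasGrowth d E β := by
  intro b hb hbβ
  have hf := frequently_lt_of_lt_limsup (by isBoundedDefault) (hbβ.trans_le hβ)
  refine (hf.and_eventually eventually_lt_one).mono ?_
  rintro ε ⟨hε, h0, h1⟩
  -- The supremum may be infinite or not visibly attained; it suffices that it exceeds this integer,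
  -- and then `n + 1` points are kept.
  set n := ⌊Real.exp (ε ^ (-b))⌋₊ with hn
  have hlt : (n : ℕ∞) < separatedNumber d E ε := by
    generalize separatedNumber d E ε = N at hε
    induction N using ENat.recTopCoe with
    | top => exact ENat.natCast_lt_top n
    | coe m =>
      have := exp_lt_of_lt_logLog_div h0 h1 hb.le hε
      exact_mod_cast (Nat.floor_lt (Real.exp_pos _).le).2 this
  rw [separatedNumber] at hlt
  obtain ⟨F, hlt⟩ := lt_iSup_iff.1 hlt
  obtain ⟨⟨hFE, hF⟩, hlt⟩ := lt_iSup_iff.1 hlt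
  obtain ⟨T, hTF, hT⟩ := Set.exists_subset_encard_eq (Order.add_one_le_of_lt hlt)
  have hTfin : T.Finite := Set.finite_of_encard_eq_coe (k := n + 1) (by rw [hT]; rfl)
  refine ⟨hTfin.toFinset, by simpa using hTF.trans hFE, ?_, ?_⟩
  · simpa [IsSep] using hF.mono hTF
  · rw [hTfin.encard_eq_coe_toFinset_card] at hT
    have : hTfin.toFinset.card = n + 1 := by exact_mod_cast hT
    rw [this]
    exact_mod_cast Nat.lt_floor_add_one _

/-- `E` is covered by finitely many sets of arbitrarily small diameter. -/
def IsFinitelyCovered (d : M → M → ℝ≥0∞) (E : Set M) : Prop :=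
  ∀ s : ℝ, 0 < s → ∃ t : Finset (Set M), E ⊆ ⋃ B ∈ t, B ∧
    ∀ B ∈ t, ∀ x ∈ E ∩ B, ∀ y ∈ E ∩ B, d x y ≤ ENNReal.ofReal s

lemma HasGrowth.exists_small_subset {β : EReal} (hβ : 0 < β) (hE : IsFinitelyCovered d E)
    {A : Set M} (hAE : A ⊆ E) (hA : HasGrowth d A β) {s : ℝ} (hs : 0 < s) :
    ∃ B ⊆ A, HasGrowth d B β ∧ ∀ x ∈ B, ∀ y ∈ B, d x y ≤ ENNReal.ofReal s := by
  obtain ⟨b, hb0, hbβ⟩ := EReal.lt_iff_exists_real_btwn.1 hβ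
  obtain ⟨t, ht, hd⟩ := hE s hs
  have hA' : HasGrowth d (⋃ B ∈ t, A ∩ B) β := by
    rwa [← Set.inter_iUnion₂, Set.inter_eq_left.2 (hAE.trans ht)]
  obtain ⟨B, hB, hg⟩ := hA'.biUnion (by exact_mod_cast hb0) hbβ t
  exact ⟨A ∩ B, Set.inter_subset_left, hg, fun x hx y hy =>
    hd B hB x ⟨hAE hx.1, hx.2⟩ y ⟨hAE hy.1, hy.2⟩⟩

lemma HasGrowth.exists_antitone {β : EReal} (hβ : 0 < β) (hE : IsFinitelyCovered d E)
    (hg : HasGrowth d E β) (s : ℕ → ℝ) (hs : ∀ n, 0 < s n) :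
    ∃ A : ℕ → Set M, Antitone A ∧ ∀ n, A n ⊆ E ∧ HasGrowth d (A n) β ∧
      ∀ x ∈ A n, ∀ y ∈ A n, d x y ≤ ENNReal.ofReal (s n) := by
  let S := {A : Set M // A ⊆ E ∧ HasGrowth d A β}
  have step : ∀ (A : S) (n : ℕ), ∃ B : S, B.1 ⊆ A.1 ∧
      ∀ x ∈ B.1, ∀ y ∈ B.1, d x y ≤ ENNReal.ofReal (s n) := fun A n => by
    obtain ⟨B, hBA, hB, hd⟩ := A.2.2.exists_small_subset hβ hE A.2.1 (hs n)
    exact ⟨⟨B, hBA.trans A.2.1, hB⟩, hBA, hd⟩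
  choose next hsub hdiam using step
  let A : ℕ → S := fun n => Nat.rec (next ⟨E, subset_rfl, hg⟩ 0) (fun k B => next B (k + 1)) n
  refine ⟨fun n => (A n).1, antitone_nat_of_succ_le fun n => hsub _ _, fun n =>
    ⟨(A n).2.1, (A n).2.2, ?_⟩⟩
  cases n <;> exact hdiam _ _

/-- Finite subsets of `E`, closer and closer to each other, whose cardinalities realize the
growth order `β` at their scales of separation, and whose covering numbers do not exceed it. -/
theorem exists_separated_sequence {β : EReal} (hβ : 0 < β) (hE : IsFinitelyCovered d E)
    (hself : ∀ x ∈ E, d x x = 0) (hsymm : ∀ x ∈ E, ∀ y ∈ E, d x y = d y x)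
    (hg : β ≤ upperMetricOrder d E) (s : ℕ → ℝ) (hs : ∀ n, 0 < s n) :
    ∃ (F : ℕ → Finset M) (r b : ℕ → ℝ), Tendsto (fun n => (b n : EReal)) atTop (𝓝 β) ∧
      (∀ m n, m ≤ n → ∀ x ∈ F m, ∀ y ∈ F n, d x y ≤ ENNReal.ofReal (s m)) ∧
      ∀ n, (F n : Set M) ⊆ E ∧ 0 < r n ∧ r n ≤ s n ∧ IsSep d (F n) (r n) ∧
        Real.exp (r n ^ (-b n)) < (F n).card ∧ (b n : EReal) < β ∧
        ∀ ε : ℝ, 0 < ε → ∃ T ⊆ F n, (T.card : ℝ) ≤ Real.exp (ε ^ (-b n)) + 1 ∧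
          ∀ x ∈ F n, ∃ y ∈ T, d x y ≤ ENNReal.ofReal ε := by
  obtain ⟨A, hA, hA'⟩ := (hasGrowth_of_le_upperMetricOrder hg).exists_antitone hβ hE s hs
  obtain ⟨c, -, hc, hclim⟩ := exists_seq_strictMono_tendsto' hβ
  have hb : ∀ n, ∃ b : ℝ, c n < b ∧ (b : EReal) < β := fun n =>
    EReal.lt_iff_exists_real_btwn.1 (hc n).2
  choose b hcb hbβ using hb
  have hb0 : ∀ n, 0 < b n := fun n => by exact_mod_cast (hc n).1.trans (hcb n)
  have hF : ∀ n, ∃ (F : Finset M) (r : ℝ), (F : Set M) ⊆ A n ∧ 0 < r ∧ IsSep d F r ∧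
      Real.exp (r ^ (-b n)) < F.card ∧
      ∀ ε : ℝ, 0 < ε → ∀ T ⊆ F, IsSep d T ε → (T.card : ℝ) ≤ Real.exp (ε ^ (-b n)) + 1 := by
    intro n
    obtain ⟨ε, ⟨G, hGA, hG, hcard⟩, hε, -⟩ :=
      (((hA' n).2.1 (b n) (hb0 n) (hbβ n)).and_eventually eventually_lt_one).exists
    obtain ⟨F, hFG, r, hr, h1, h2, h3⟩ := exists_sep_subset hε hG hcard
    exact ⟨F, r, (Finset.coe_subset.2 hFG).trans hGA, hr, h1, h2, h3⟩
  choose F r hFA hr hsep hcard hcov using hF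
  refine ⟨F, r, b, ?_, ?_, fun n => ⟨(hFA n).trans (hA' n).1, hr n, ?_, hsep n, hcard n, hbβ n, ?_⟩⟩
  · exact tendsto_of_tendsto_of_tendsto_of_le_of_le hclim tendsto_const_nhds
      (fun n => (hcb n).le) (fun n => (hbβ n).le)
  · exact fun m n hmn x hx y hy => (hA' m).2.2 x (hFA m hx) y (hA hmn (hFA n hy))
  -- Two distinct points of `F n` are at distance at least `r n` and at most `s n`.
  · have h1 : (1 : ℝ) < (F n).card :=
      (Real.one_le_exp (Real.rpow_nonneg (hr n).le _)).trans_lt (hcard n)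
    obtain ⟨x, hx, y, hy, hxy⟩ := Finset.one_lt_card.1 (by exact_mod_cast h1 : 1 < (F n).card)
    have := (hsep n hx hy hxy).trans ((hA' n).2.2 x (hFA n hx) y (hFA n hy))
    exact (ENNReal.ofReal_le_ofReal_iff (hs n).le).1 this
  · intro ε hε
    have hsub := (hFA n).trans (hA' n).1
    obtain ⟨T, hTF, hT, hnet⟩ := exists_sep_net (F n) ε
      (fun x hx => by rw [hself x (hsub hx)]; exact zero_le)
      (fun x hx y hy => hsymm x (hsub hx) y (hsub hy))
    exact ⟨T, hTF, hcov n ε hε T hTF hT, hnet⟩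

end Separated

/-! ### Variation on a finite partition -/

section Variation

variable {X : Type*} [MeasurableSpace X]

/-- The variation distance of two measures on the partition into the level sets of `q`. -/
noncomputable def partitionVariation {Y : Type*} (q : SimpleFunc X Y) (μ ν : Measure X) : ℝ≥0∞ :=
  ∑ y ∈ q.range, ENNReal.ofReal |μ.real (q ⁻¹' {y}) - ν.real (q ⁻¹' {y})|

lemma partitionVariation_comm {Y : Type*} (q : SimpleFunc X Y) (μ ν : Measure X) :
    partitionVariation q μ ν = partitionVariation q ν μ := by
  simp only [partitionVariation, abs_sub_comm]

lemma measure_sub_le_ofReal_abs {μ ν : Measure X} [IsFiniteMeasure μ] [IsFiniteMeasure ν]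
    (s : Set X) : μ s - ν s ≤ ENNReal.ofReal |μ.real s - ν.real s| := by
  rw [← ofReal_measureReal, ← ofReal_measureReal (μ := ν),
    ← ENNReal.ofReal_sub _ measureReal_nonneg]
  exact ENNReal.ofReal_le_ofReal (le_abs_self _)

lemma measure_preimage_le_add_partitionVariation {Y : Type*} (q : SimpleFunc X Y)
    (μ ν : Measure X) [IsFiniteMeasure μ] [IsFiniteMeasure ν] (I : Set Y) :
    μ (q ⁻¹' I) ≤ ν (q ⁻¹' I) + partitionVariation q μ ν := by
  classical
  have key : ∀ m : Measure X,
      m (q ⁻¹' I) = ∑ y ∈ q.range.filter (· ∈ I), m (q ⁻¹' {y}) := fun m => by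
    rw [q.sum_measure_preimage_singleton]
    congr 1
    ext x
    simp
  rw [key, key, partitionVariation]
  calc ∑ y ∈ q.range.filter (· ∈ I), μ (q ⁻¹' {y})
      ≤ ∑ y ∈ q.range.filter (· ∈ I), (ν (q ⁻¹' {y}) +
          ENNReal.ofReal |μ.real (q ⁻¹' {y}) - ν.real (q ⁻¹' {y})|) :=
        Finset.sum_le_sum fun y _ =>
          tsub_le_iff_left.1 (measure_sub_le_ofReal_abs (q ⁻¹' {y}))
    _ ≤ _ := by
        rw [Finset.sum_add_distrib]
        gcongr
        exact Finset.filter_subset _ _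

end Variation

/-! ### Control of the distances by finite partitions -/

section Distances

variable {X : Type*} [MetricSpace X] [CompactSpace X] [Nonempty X]
  [MeasurableSpace X] [BorelSpace X]

/-- The properties of a distance on probability measures that are used below. In the last one, the
distance is small as soon as the measures are close to each other on a suitable finite
partition. -/
structure IsPartitionDist (D : Measure X → Measure X → ℝ≥0∞) : Prop where
  symm : ∀ μ ν : Measure X, D μ ν = D ν μ
  triangle : ∀ (μ ν κ : Measure X) [IsProbabilityMeasure μ] [IsProbabilityMeasure ν]
    [IsProbabilityMeasure κ], D μ κ ≤ D μ ν + D ν κ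
  bounded : ∃ C : ℝ≥0∞, C ≠ ∞ ∧ ∀ (μ ν : Measure X) [IsProbabilityMeasure μ]
    [IsProbabilityMeasure ν], D μ ν ≤ C
  control : ∀ η : ℝ≥0∞, 0 < η → η ≠ ∞ → ∃ (q : SimpleFunc X X) (v : ℝ≥0∞), 0 < v ∧ v ≠ ∞ ∧
    ∀ (μ ν : Measure X) [IsProbabilityMeasure μ] [IsProbabilityMeasure ν],
      partitionVariation q μ ν ≤ v → D μ ν ≤ η

lemma exists_simpleFunc_edist_le {η : ℝ≥0∞} (hη : 0 < η) :
    ∃ q : SimpleFunc X X, ∀ x, edist x (q x) ≤ η := by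
  let e := TopologicalSpace.denseSeq X
  have hcov : (Set.univ : Set X) ⊆ ⋃ n, Metric.eball (e n) η := fun x _ => by
    have := TopologicalSpace.denseRange_denseSeq X
    obtain ⟨n, hn⟩ := this.exists_mem_open Metric.isOpen_eball ⟨x, Metric.mem_eball_self hη⟩
    exact Set.mem_iUnion.2 ⟨n, Metric.mem_eball_comm.1 hn⟩
  obtain ⟨t, ht⟩ := isCompact_univ.elim_finite_subcover _ (fun n => Metric.isOpen_eball) hcov
  refine ⟨SimpleFunc.nearestPt e (t.sup id), fun x => ?_⟩
  obtain ⟨n, hn, hx⟩ := Set.mem_iUnion₂.1 (ht (Set.mem_univ x))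
  rw [edist_comm]
  refine (SimpleFunc.edist_nearestPt_le e x (Finset.le_sup (f := id) hn)).trans ?_
  rw [edist_comm]
  exact (Metric.mem_eball.1 hx).le

lemma isPartitionDist_levyProkhorovEDist :
    IsPartitionDist (levyProkhorovEDist : Measure X → Measure X → ℝ≥0∞) where
  symm := levyProkhorovEDist_comm
  triangle μ ν κ _ _ _ := levyProkhorovEDist_triangle μ ν κ
  bounded := ⟨1, ENNReal.one_ne_top, fun μ ν _ _ => by
    simpa using levyProkhorovEDist_le_max_measure_univ μ ν⟩
  control η hη hη' := by
    obtain ⟨q, hq⟩ := exists_simpleFunc_edist_le (X := X) (ENNReal.half_pos hη.ne')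
    refine ⟨q, η, hη, hη', fun μ ν _ _ hv => ?_⟩
    have key : ∀ (μ ν : Measure X) [IsProbabilityMeasure μ] [IsProbabilityMeasure ν],
        partitionVariation q μ ν ≤ η → ∀ (ε : ℝ≥0∞) (B : Set X), η < ε → ε < ∞ →
        μ B ≤ ν (Metric.thickening ε.toReal B) + ε := by
      intro μ ν _ _ hv ε B hε hε'
      -- `B` is enlarged to the union of the cells that it meets. Cells have diameter at most `η <
      -- ε`, so this union stays in the thickening.
      calc μ B ≤ μ (q ⁻¹' (q '' B)) := measure_mono (Set.subset_preimage_image q B)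
        _ ≤ ν (q ⁻¹' (q '' B)) + partitionVariation q μ ν :=
          measure_preimage_le_add_partitionVariation q μ ν _
        _ ≤ ν (Metric.thickening ε.toReal B) + ε := by
          gcongr
          · rintro x ⟨b, hb, hbx⟩
            rw [Metric.mem_thickening_iff_exists_edist_lt]
            refine ⟨b, hb, ?_⟩
            rw [ENNReal.ofReal_toReal hε'.ne]
            calc edist x b ≤ edist x (q x) + edist (q x) b := edist_triangle _ _ _
              _ = edist x (q x) + edist b (q b) := by rw [hbx, edist_comm b]
              _ ≤ η / 2 + η / 2 := add_le_add (hq x) (hq b)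
              _ = η := ENNReal.add_halves η
              _ < ε := hε
          · exact hv.trans hε.le
    exact levyProkhorovEDist_le_of_forall μ ν η fun ε B hε hε' _ =>
      ⟨key μ ν hv ε B hε hε', key ν μ (by rwa [partitionVariation_comm]) ε B hε hε'⟩

/-! ### Wasserstein distances -/

section Wasserstein

variable {p : ℝ}

lemma wassersteinEDist_le {μ ν : Measure X} (π : Measure (X × X)) (h₁ : π.map Prod.fst = μ)
    (h₂ : π.map Prod.snd = ν) :
    wassersteinEDist p μ ν ≤ (∫⁻ z, (edist z.1 z.2) ^ p ∂π) ^ (1 / p) :=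
  iInf₂_le π ⟨h₁, h₂⟩

lemma measurable_edist_rpow : Measurable fun z : X × X => (edist z.1 z.2) ^ p :=
  measurable_edist.pow_const p

lemma wassersteinEDist_le_swap (μ ν : Measure X) :
    wassersteinEDist p μ ν ≤ wassersteinEDist p ν μ := by
  refine le_iInf₂ fun π hπ => ?_
  refine (wassersteinEDist_le (π.map Prod.swap) ?_ ?_).trans_eq ?_
  · rw [Measure.map_map measurable_fst measurable_swap]; exact hπ.2
  · rw [Measure.map_map measurable_snd measurable_swap]; exact hπ.1
  · rw [lintegral_map measurable_edist_rpow measurable_swap]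
    simp only [Prod.fst_swap, Prod.snd_swap, edist_comm]

lemma wassersteinEDist_comm (μ ν : Measure X) :
    wassersteinEDist p μ ν = wassersteinEDist p ν μ :=
  le_antisymm (wassersteinEDist_le_swap μ ν) (wassersteinEDist_le_swap ν μ)

/-- Two probability measures on products with a common first marginal can be glued. -/
lemma exists_gluing (π₁ π₂ : Measure (X × X)) [IsProbabilityMeasure π₁] [IsProbabilityMeasure π₂]
    (h : π₁.fst = π₂.fst) : ∃ γ : Measure (X × X × X),
      γ.map (fun w => (w.1, w.2.1)) = π₁ ∧ γ.map (fun w => (w.1, w.2.2)) = π₂ := by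
  -- Given the common coordinate, the other two are drawn independently from the conditional laws.
  refine ⟨π₁.fst.compProd (ProbabilityTheory.Kernel.prod π₁.condKernel π₂.condKernel), ?_, ?_⟩
  · conv_rhs => rw [← π₁.disintegrate π₁.condKernel]
    ext s hs
    rw [Measure.map_apply (by fun_prop) hs, Measure.compProd_apply (by measurability),
      Measure.compProd_apply hs]
    refine lintegral_congr fun a => ?_
    rw [ProbabilityTheory.Kernel.prod_apply]
    have : (Prod.mk a ⁻¹' ((fun w : X × X × X => (w.1, w.2.1)) ⁻¹' s) : Set (X × X)) =
        (Prod.mk a ⁻¹' s) ×ˢ Set.univ := by ext; simp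
    rw [this, Measure.prod_prod]; simp
  · conv_rhs => rw [← π₂.disintegrate π₂.condKernel, ← h]
    ext s hs
    rw [Measure.map_apply (by fun_prop) hs, Measure.compProd_apply (by measurability),
      Measure.compProd_apply hs]
    refine lintegral_congr fun a => ?_
    rw [ProbabilityTheory.Kernel.prod_apply]
    have : (Prod.mk a ⁻¹' ((fun w : X × X × X => (w.1, w.2.2)) ⁻¹' s) : Set (X × X)) =
        Set.univ ×ˢ (Prod.mk a ⁻¹' s) := by ext; simp
    rw [this, Measure.prod_prod]; simp

lemma wassersteinEDist_triangle (hp : 1 ≤ p) (μ ν κ : Measure X) [IsProbabilityMeasure ν] :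
    wassersteinEDist p μ κ ≤ wassersteinEDist p μ ν + wassersteinEDist p ν κ := by
  -- After the swap both couplings have `ν` as first marginal, the form needed for gluing;
  -- Minkowski's inequality then gives the bound.
  rw [wassersteinEDist_comm μ ν]
  refine ENNReal.le_iInf₂_add_iInf₂ fun π₁ h₁ π₂ h₂ => ?_
  have i₁ : IsProbabilityMeasure π₁ := by
    rw [← Measure.isProbabilityMeasure_map_iff (f := Prod.fst) measurable_fst.aemeasurable, h₁.1]
    infer_instance
  have i₂ : IsProbabilityMeasure π₂ := by
    rw [← Measure.isProbabilityMeasure_map_iff (f := Prod.fst) measurable_fst.aemeasurable, h₂.1]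
    infer_instance
  obtain ⟨γ, hγ₁, hγ₂⟩ := exists_gluing π₁ π₂ (h₁.1.trans h₂.1.symm)
  have hm₁ : Measurable fun w : X × X × X => (w.1, w.2.1) := by fun_prop
  have hm₂ : Measurable fun w : X × X × X => (w.1, w.2.2) := by fun_prop
  have hp0 : 0 ≤ p := by linarith
  calc wassersteinEDist p μ κ
      ≤ (∫⁻ z, (edist z.1 z.2) ^ p ∂(γ.map Prod.snd)) ^ (1 / p) := by
        refine wassersteinEDist_le _ ?_ ?_
        · rw [Measure.map_map measurable_fst measurable_snd, ← h₁.2, ← hγ₁,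
            Measure.map_map measurable_snd hm₁]; rfl
        · rw [Measure.map_map measurable_snd measurable_snd, ← h₂.2, ← hγ₂,
            Measure.map_map measurable_snd hm₂]; rfl
    _ = (∫⁻ w, (edist w.2.1 w.2.2) ^ p ∂γ) ^ (1 / p) := by
        rw [lintegral_map measurable_edist_rpow measurable_snd]
    _ ≤ (∫⁻ w, ((fun w : X × X × X => edist w.1 w.2.1) +
          (fun w : X × X × X => edist w.1 w.2.2)) w ^ p ∂γ) ^ (1 / p) := by
        gcongr with w
        exact edist_triangle_left _ _ _
    _ ≤ (∫⁻ w, (edist w.1 w.2.1) ^ p ∂γ) ^ (1 / p) + (∫⁻ w, (edist w.1 w.2.2) ^ p ∂γ) ^ (1 / p) :=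
        ENNReal.lintegral_Lp_add_le (measurable_edist.comp hm₁).aemeasurable
          (measurable_edist.comp hm₂).aemeasurable hp
    _ = _ := by
        rw [← hγ₁, ← hγ₂, lintegral_map measurable_edist_rpow hm₁,
          lintegral_map measurable_edist_rpow hm₂]

lemma rpow_rpow_one_div (hp : 1 ≤ p) (x : ℝ≥0∞) : (x ^ p) ^ (1 / p) = x := by
  rw [one_div, ENNReal.rpow_rpow_inv (by linarith)]

/-- The common part `ρ` stays in place on the diagonal, and `μ` is carried to `ν` by the normalized
product coupling at distance at most `C`. -/
lemma wassersteinEDist_add_le (hp : 1 ≤ p) {C : ℝ≥0∞} (hC : ∀ x y : X, edist x y ≤ C)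
    (ρ μ ν : Measure X) [IsFiniteMeasure ρ] [IsFiniteMeasure μ] [IsFiniteMeasure ν]
    (h : μ Set.univ = ν Set.univ) :
    wassersteinEDist p (ρ + μ) (ρ + ν) ≤ (C ^ p * μ Set.univ) ^ (1 / p) := by
  have hp0 : 0 < p := by linarith
  have hd : Measurable fun x : X => (x, x) := by fun_prop
  have hcancel : ∀ m : Measure X, m Set.univ = μ Set.univ →
      ((μ Set.univ)⁻¹ * μ Set.univ) • m = m := fun m hm => by
    rcases eq_or_ne (μ Set.univ) 0 with h0 | h0
    · rw [h0, Measure.measure_univ_eq_zero] at hm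
      simp [hm]
    · rw [ENNReal.inv_mul_cancel h0 (measure_ne_top _ _), one_smul]
  refine (wassersteinEDist_le (ρ.map (fun x => (x, x)) + (μ Set.univ)⁻¹ • μ.prod ν) ?_ ?_).trans ?_
  · rw [Measure.map_add _ _ measurable_fst, Measure.map_map measurable_fst hd, Measure.map_smul,
      Measure.map_fst_prod, smul_smul, ← h, hcancel μ rfl]
    congr 1
    exact Measure.map_id
  · rw [Measure.map_add _ _ measurable_snd, Measure.map_map measurable_snd hd, Measure.map_smul,
      Measure.map_snd_prod, smul_smul, hcancel ν h.symm]
    congr 1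
    exact Measure.map_id
  · gcongr
    rw [lintegral_add_measure, lintegral_map measurable_edist_rpow hd, lintegral_smul_measure]
    simp only [edist_self, ENNReal.zero_rpow_of_pos hp0, lintegral_zero, zero_add, smul_eq_mul]
    calc (μ Set.univ)⁻¹ * ∫⁻ z, (edist z.1 z.2) ^ p ∂(μ.prod ν)
        ≤ (μ Set.univ)⁻¹ * ∫⁻ _, C ^ p ∂(μ.prod ν) := by
          gcongr with z
          exact hC _ _
      _ = ((μ Set.univ)⁻¹ * μ Set.univ) * (C ^ p * μ Set.univ) := by
          rw [lintegral_const, ← Set.univ_prod_univ, Measure.prod_prod, ← h]; ring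
      _ ≤ 1 * (C ^ p * μ Set.univ) := by gcongr; exact ENNReal.inv_mul_le_one _
      _ = _ := one_mul _

lemma map_simpleFunc_eq_sum (q : SimpleFunc X X) (μ : Measure X) :
    μ.map q = ∑ y ∈ q.range, μ (q ⁻¹' {y}) • Measure.dirac y := by
  classical
  ext s hs
  rw [Measure.map_apply q.measurable hs, Measure.finsetSum_apply]
  have : (q ⁻¹' s : Set X) = q ⁻¹' (q.range.filter (· ∈ s) : Finset X) := by ext; simp
  rw [this, ← q.sum_measure_preimage_singleton, Finset.sum_filter]
  refine Finset.sum_congr rfl fun y _ => ?_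
  by_cases hy : y ∈ s <;> simp [hs, hy]

/-- Both images are sums of atoms. The minimum of the two masses at each atom is left in place, and
only the excess, whose mass is at most the variation, is moved. -/
lemma wassersteinEDist_map_le (hp : 1 ≤ p) {C : ℝ≥0∞} (hC : ∀ x y : X, edist x y ≤ C)
    (q : SimpleFunc X X) (μ ν : Measure X) [IsProbabilityMeasure μ] [IsProbabilityMeasure ν] :
    wassersteinEDist p (μ.map q) (ν.map q) ≤ (C ^ p * partitionVariation q μ ν) ^ (1 / p) := by
  let ρ : Measure X := ∑ y ∈ q.range, min (μ (q ⁻¹' {y})) (ν (q ⁻¹' {y})) • Measure.dirac y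
  let μ' : Measure X := ∑ y ∈ q.range, (μ (q ⁻¹' {y}) - ν (q ⁻¹' {y})) • Measure.dirac y
  let ν' : Measure X := ∑ y ∈ q.range, (ν (q ⁻¹' {y}) - μ (q ⁻¹' {y})) • Measure.dirac y
  have hμ : μ.map q = ρ + μ' := by
    rw [map_simpleFunc_eq_sum, ← Finset.sum_add_distrib]
    refine Finset.sum_congr rfl fun y _ => ?_
    rw [← add_smul, add_comm, tsub_add_min]
  have hν : ν.map q = ρ + ν' := by
    rw [map_simpleFunc_eq_sum, ← Finset.sum_add_distrib]
    refine Finset.sum_congr rfl fun y _ => ?_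
    rw [← add_smul, add_comm, min_comm, tsub_add_min]
  have pμ : IsProbabilityMeasure (μ.map q) :=
    Measure.isProbabilityMeasure_map q.measurable.aemeasurable
  have pν : IsProbabilityMeasure (ν.map q) :=
    Measure.isProbabilityMeasure_map q.measurable.aemeasurable
  have uμ : ρ Set.univ + μ' Set.univ = 1 := by rw [← Measure.add_apply, ← hμ, measure_univ]
  have uν : ρ Set.univ + ν' Set.univ = 1 := by rw [← Measure.add_apply, ← hν, measure_univ]
  have hlt : ∀ {a b : ℝ≥0∞}, a + b = 1 → a < ∞ ∧ b < ∞ := fun {a b} h => by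
    rw [← ENNReal.add_lt_top, h]; exact ENNReal.one_lt_top
  have : IsFiniteMeasure ρ := ⟨(hlt uμ).1⟩
  have : IsFiniteMeasure μ' := ⟨(hlt uμ).2⟩
  have : IsFiniteMeasure ν' := ⟨(hlt uν).2⟩
  have huniv : μ' Set.univ = ν' Set.univ :=
    (ENNReal.add_right_inj (hlt uμ).1.ne).1 (uμ.trans uν.symm)
  rw [hμ, hν]
  refine (wassersteinEDist_add_le hp hC ρ μ' ν' huniv).trans ?_
  gcongr
  rw [Measure.finsetSum_apply, partitionVariation]
  refine Finset.sum_le_sum fun y _ => ?_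
  simpa using measure_sub_le_ofReal_abs (q ⁻¹' {y})

lemma wassersteinEDist_map_self_le (hp : 1 ≤ p) {δ : ℝ≥0∞} (q : SimpleFunc X X)
    (hq : ∀ x, edist x (q x) ≤ δ) (μ : Measure X) [IsProbabilityMeasure μ] :
    wassersteinEDist p μ (μ.map q) ≤ δ := by
  have hm : Measurable fun x => (x, q x) := measurable_id.prodMk q.measurable
  refine (wassersteinEDist_le (μ.map fun x => (x, q x)) ?_ ?_).trans ?_
  · rw [Measure.map_map measurable_fst hm]; exact Measure.map_id
  · rw [Measure.map_map measurable_snd hm]; rfl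
  · rw [lintegral_map measurable_edist_rpow hm]
    calc (∫⁻ x, (edist x (q x)) ^ p ∂μ) ^ (1 / p) ≤ (∫⁻ _, δ ^ p ∂μ) ^ (1 / p) := by
          gcongr with x
          exact hq x
      _ = δ := by simp [(by linarith : 0 < p).ne']

lemma isPartitionDist_wassersteinEDist (hp : 1 ≤ p) :
    IsPartitionDist (wassersteinEDist p : Measure X → Measure X → ℝ≥0∞) := by
  have hp0 : 0 < p := by linarith
  obtain ⟨C, hC0, hCtop, hC⟩ : ∃ C : ℝ≥0∞, C ≠ 0 ∧ C ≠ ∞ ∧ ∀ x y : X, edist x y ≤ C := by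
    -- The `+ 1` keeps `C` nonzero when `X` is a single point, since `C ^ p` is a divisor below.
    refine ⟨ENNReal.ofReal (Metric.diam (Set.univ : Set X) + 1), ?_, ENNReal.ofReal_ne_top,
      fun x y => ?_⟩
    · simpa using add_pos_of_nonneg_of_pos Metric.diam_nonneg one_pos
    · rw [edist_dist]
      apply ENNReal.ofReal_le_ofReal
      have := Metric.dist_le_diam_of_mem (isCompact_univ (X := X)).isBounded
        (Set.mem_univ x) (Set.mem_univ y)
      linarith
  refine ⟨wassersteinEDist_comm, fun μ ν κ _ _ _ => wassersteinEDist_triangle hp μ ν κ,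
    ⟨C, hCtop, fun μ ν _ _ => ?_⟩, fun η hη hη' => ?_⟩
  · have := wassersteinEDist_add_le hp hC 0 μ ν (by simp)
    simpa [← one_div, rpow_rpow_one_div hp] using this
  · have h4 : 0 < η / 2 / 2 := ENNReal.half_pos (ENNReal.half_pos hη.ne').ne'
    obtain ⟨q, hq⟩ := exists_simpleFunc_edist_le (X := X) h4
    have hCp0 : C ^ p ≠ 0 := (ENNReal.rpow_pos (pos_iff_ne_zero.2 hC0) hCtop).ne'
    have hCp : C ^ p ≠ ∞ := ENNReal.rpow_ne_top_of_nonneg hp0.le hCtop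
    have hηp : (η / 2) ^ p ≠ ∞ :=
      ENNReal.rpow_ne_top_of_nonneg hp0.le (ENNReal.div_ne_top hη' two_ne_zero)
    refine ⟨q, (η / 2) ^ p / C ^ p, ?_, ENNReal.div_ne_top hηp hCp0, fun μ ν _ _ hv => ?_⟩
    · exact ENNReal.div_pos (ENNReal.rpow_pos (ENNReal.half_pos hη.ne')
        (ENNReal.div_ne_top hη' two_ne_zero)).ne' hCp
    · have pμ : IsProbabilityMeasure (μ.map q) :=
        Measure.isProbabilityMeasure_map q.measurable.aemeasurable
      have pν : IsProbabilityMeasure (ν.map q) :=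
        Measure.isProbabilityMeasure_map q.measurable.aemeasurable
      calc wassersteinEDist p μ ν
          ≤ wassersteinEDist p μ (μ.map q) + wassersteinEDist p (μ.map q) ν :=
            wassersteinEDist_triangle hp _ _ _
        _ ≤ wassersteinEDist p μ (μ.map q) + (wassersteinEDist p (μ.map q) (ν.map q) +
              wassersteinEDist p (ν.map q) ν) := by
            gcongr
            exact wassersteinEDist_triangle hp _ _ _
        _ ≤ η / 2 / 2 + (η / 2 + η / 2 / 2) := by
            gcongr
            · exact wassersteinEDist_map_self_le hp q hq μ
            · refine (wassersteinEDist_map_le hp hC q μ ν).trans ?_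
              calc (C ^ p * partitionVariation q μ ν) ^ (1 / p)
                  ≤ (C ^ p * ((η / 2) ^ p / C ^ p)) ^ (1 / p) := by gcongr
                _ = η / 2 := by
                  rw [ENNReal.mul_div_cancel hCp0 hCp, rpow_rpow_one_div hp]
            · rw [wassersteinEDist_comm]
              exact wassersteinEDist_map_self_le hp q hq ν
        _ = η := by
            rw [add_left_comm, ENNReal.add_halves, ENNReal.add_halves]

end Wasserstein

lemma IsWassersteinOrLevyProkhorov.isPartitionDist {D : Measure X → Measure X → ℝ≥0∞}
    (hD : IsWassersteinOrLevyProkhorov D) : IsPartitionDist D := by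
  rcases hD with ⟨p, hp, rfl⟩ | rfl
  · exact isPartitionDist_wassersteinEDist hp
  · exact isPartitionDist_levyProkhorovEDist


variable {D : Measure X → Measure X → ℝ≥0∞}

lemma IsPartitionDist.self_eq_zero (hD : IsPartitionDist D) (μ : Measure X)
    [IsProbabilityMeasure μ] : D μ μ = 0 := by
  refine le_antisymm (ENNReal.le_of_forall_pos_le_add fun η hη _ => ?_) zero_le
  obtain ⟨q, v, -, -, h⟩ := hD.control η (by exact_mod_cast hη) ENNReal.coe_ne_top
  simpa using h μ μ (by simp [partitionVariation])

/-- The distance is controlled linearly by the variation on a finite partition, up to a small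
error. -/
lemma IsPartitionDist.exists_le_add_mul (hD : IsPartitionDist D) {η : ℝ≥0∞} (hη : 0 < η)
    (hη' : η ≠ ∞) : ∃ (q : SimpleFunc X X) (K : ℝ≥0∞), K ≠ ∞ ∧ ∀ (μ ν : Measure X)
      [IsProbabilityMeasure μ] [IsProbabilityMeasure ν],
      D μ ν ≤ η + K * partitionVariation q μ ν := by
  obtain ⟨q, v, hv0, hv, h⟩ := hD.control η hη hη'
  obtain ⟨C, hC, hDC⟩ := hD.bounded
  refine ⟨q, C / v, ENNReal.div_ne_top hC hv0.ne', fun μ ν _ _ => ?_⟩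
  rcases le_total (partitionVariation q μ ν) v with hle | hle
  · exact (h μ ν hle).trans le_self_add
  · calc D μ ν ≤ C := hDC μ ν
      _ = C / v * v := (ENNReal.div_mul_cancel hv0.ne' hv).symm
      _ ≤ C / v * partitionVariation q μ ν := by gcongr
      _ ≤ _ := le_add_self

/-- The vectors of cell masses lie in a compact cube. Preimages of small balls of a finite cover
have small variation, hence small `D`-diameter. -/
lemma IsPartitionDist.isFinitelyCovered (hD : IsPartitionDist D) {E : Set (Measure X)}
    (hE : ∀ μ ∈ E, IsProbabilityMeasure μ) : IsFinitelyCovered D E := by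
  classical
  intro s hs
  obtain ⟨q, v, hv0, hv, h⟩ := hD.control (ENNReal.ofReal s) (by simpa) ENNReal.ofReal_ne_top
  let Φ : Measure X → (q.range → ℝ) := fun μ y => μ.real (q ⁻¹' {y.1})
  -- Each cell contributes at most `2 * e`, so the total over all cells is at most `v`.
  let e : ℝ := v.toReal / (2 * (q.range.card + 1))
  have hvpos : 0 < v.toReal := ENNReal.toReal_pos hv0.ne' hv
  have he : 0 < e := by positivity
  obtain ⟨t, -, htfin, ht⟩ :=
    (isCompact_Icc : IsCompact (Set.Icc (0 : q.range → ℝ) 1)).finite_cover_balls he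
  refine ⟨htfin.toFinset.image fun z => Φ ⁻¹' Metric.ball z e, fun μ hμ => ?_, fun B hB => ?_⟩
  · have := hE μ hμ
    have hmem : Φ μ ∈ Set.Icc (0 : q.range → ℝ) 1 :=
      ⟨fun y => measureReal_nonneg, fun y => measureReal_le_one⟩
    obtain ⟨z, hz, hz'⟩ := Set.mem_iUnion₂.1 (ht hmem)
    exact Set.mem_iUnion₂.2 ⟨_, Finset.mem_image_of_mem _ (by simpa using hz), hz'⟩
  · obtain ⟨z, -, rfl⟩ := Finset.mem_image.1 hB
    rintro μ ⟨hμ, hμz⟩ ν ⟨hν, hνz⟩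
    have := hE μ hμ
    have := hE ν hν
    refine h μ ν ?_
    have hd : dist (Φ μ) (Φ ν) ≤ 2 * e := by
      have h1 := Metric.mem_ball.1 hμz
      have h2 := Metric.mem_ball'.1 hνz
      linarith [dist_triangle (Φ μ) z (Φ ν)]
    calc partitionVariation q μ ν ≤ ∑ y ∈ q.range, ENNReal.ofReal (2 * e) := by
          refine Finset.sum_le_sum fun y hy => ENNReal.ofReal_le_ofReal ?_
          have := dist_le_pi_dist (Φ μ) (Φ ν) ⟨y, hy⟩
          rw [Real.dist_eq] at this
          exact this.trans hd
      _ = ENNReal.ofReal (q.range.card * (2 * e)) := by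
          rw [Finset.sum_const, nsmul_eq_mul, ENNReal.ofReal_mul (Nat.cast_nonneg _),
            ENNReal.ofReal_natCast]
      _ ≤ ENNReal.ofReal v.toReal := by
          refine ENNReal.ofReal_le_ofReal ?_
          have : (q.range.card : ℝ) * (2 * e) = q.range.card / (q.range.card + 1) * v.toReal := by
            simp only [e]; field_simp
          rw [this]
          refine mul_le_of_le_one_left hvpos.le ?_
          rw [div_le_one (by positivity)]; linarith
      _ = v := ENNReal.ofReal_toReal hv

end Distances

/-! ### The mean ergodic theorem -/

section MeanErgodic

variable {X : Type*} [MeasurableSpace X] {f : X → X} {μ : Measure X}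

lemma iterate_compMeasurePreserving_indicatorConstLp [IsFiniteMeasure μ]
    (hf : MeasurePreserving f μ μ) {A : Set X} (hA : MeasurableSet A) (n : ℕ) :
    (Lp.compMeasurePreservingₗᵢ ℝ f hf).toContinuousLinearMap^[n]
        (indicatorConstLp 2 hA (measure_ne_top μ A) (1 : ℝ)) =
      indicatorConstLp 2 ((hf.measurable.iterate n) hA) (measure_ne_top μ (f^[n] ⁻¹' A)) 1 := by
  induction n with
  | zero => rfl
  | succ n ih =>
    rw [Function.iterate_succ_apply', ih]
    have h := Lp.indicatorConstLp_compMeasurePreserving (p := 2)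
      ((hf.measurable.iterate n) hA) (measure_ne_top μ (f^[n] ⁻¹' A)) (1 : ℝ) hf
    exact h

lemma birkhoffAverage_indicatorConstLp_ae_eq [IsFiniteMeasure μ]
    (hf : MeasurePreserving f μ μ) {A : Set X} (hA : MeasurableSet A) (n : ℕ) :
    (birkhoffAverage ℝ (Lp.compMeasurePreservingₗᵢ ℝ f hf).toContinuousLinearMap id n
        (indicatorConstLp 2 hA (measure_ne_top μ A) (1 : ℝ)) : Lp ℝ 2 μ) =ᵐ[μ]
      birkhoffAverage ℝ f (A.indicator fun _ => (1 : ℝ)) n := by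
  simp only [birkhoffAverage, birkhoffSum, id, iterate_compMeasurePreserving_indicatorConstLp hf hA]
  refine (Lp.coeFn_smul _ _).trans ?_
  have h1 := Lp.coeFn_finsetSum (Finset.range n) fun k =>
    indicatorConstLp 2 ((hf.measurable.iterate k) hA) (measure_ne_top μ (f^[k] ⁻¹' A)) (1 : ℝ)
  have h2 : ∀ᵐ x ∂μ, ∀ k, indicatorConstLp 2 ((hf.measurable.iterate k) hA)
      (measure_ne_top μ (f^[k] ⁻¹' A)) (1 : ℝ) x = (f^[k] ⁻¹' A).indicator (fun _ => (1 : ℝ)) x :=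
    ae_all_iff.2 fun k => indicatorConstLp_coeFn
  filter_upwards [h1, h2] with x hx1 hx2
  simp only [Pi.smul_apply, hx1, Finset.sum_apply, hx2]
  rfl

lemma measurable_birkhoffAverage_indicator (hf : Measurable f) {A : Set X} (hA : MeasurableSet A)
    (n : ℕ) : Measurable (birkhoffAverage ℝ f (A.indicator fun _ => (1 : ℝ)) n) := by
  have h : Measurable fun x => ∑ k ∈ Finset.range n, A.indicator (fun _ => (1 : ℝ)) (f^[k] x) :=
    Finset.measurable_sum _ fun k _ =>
      (measurable_const.indicator hA).comp (hf.iterate k)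
  exact h.const_smul (n : ℝ)⁻¹

/-- The **mean ergodic theorem** in `L¹` for the time spent in a set. -/
theorem tendsto_lintegral_abs_birkhoffAverage_sub [IsProbabilityMeasure μ] (hf : Ergodic f μ)
    {A : Set X} (hA : MeasurableSet A) :
    Tendsto (fun n => ∫⁻ x, ENNReal.ofReal
      |birkhoffAverage ℝ f (A.indicator fun _ => (1 : ℝ)) n x - μ.real A| ∂μ) atTop (𝓝 0) := by
  let U := Lp.compMeasurePreservingₗᵢ (E := ℝ) (p := 2) ℝ f hf.toMeasurePreserving
  let g : Lp ℝ 2 μ := indicatorConstLp 2 hA (measure_ne_top μ A) (1 : ℝ)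
  let φ : ℕ → X → ℝ := birkhoffAverage ℝ f (A.indicator fun _ => (1 : ℝ))
  -- Von Neumann's theorem for the Koopman operator on `L²`; ergodicity makes the projection onto
  -- its fixed vectors a constant `c`.
  have hlim := U.toContinuousLinearMap.tendsto_birkhoffAverage_orthogonalProjection
    U.norm_toContinuousLinearMap_le g
  set Pg := (U.toContinuousLinearMap.eqLocus
    (1 : Lp ℝ 2 μ →L[ℝ] Lp ℝ 2 μ)).orthogonalProjectionOnto g
  have hfix : Lp.compMeasurePreserving f hf.toMeasurePreserving (Pg : Lp ℝ 2 μ) = Pg := Pg.2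
  obtain ⟨c, hc⟩ := hf.eq_const_of_compMeasurePreserving_eq
    (g := ((Pg : Lp ℝ 2 μ) : X →ₘ[μ] ℝ)) (congrArg Subtype.val hfix)
  have hPc : ((Pg : Lp ℝ 2 μ) : X → ℝ) =ᵐ[μ] fun _ => c := by
    rw [hc]; exact AEEqFun.coeFn_const X c
  have hφm : ∀ n, Measurable (φ n) := measurable_birkhoffAverage_indicator hf.measurable hA
  have hL1 : Tendsto (fun n => ∫⁻ x, ENNReal.ofReal |φ n x - c| ∂μ) atTop (𝓝 0) := by
    have h0 := (Lp.tendsto_Lp_iff_tendsto_eLpNorm' _ _).1 hlim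
    refine tendsto_of_tendsto_of_tendsto_of_le_of_le tendsto_const_nhds h0
      (fun n => zero_le) fun n => ?_
    have hae := birkhoffAverage_indicatorConstLp_ae_eq hf.toMeasurePreserving hA n
    calc ∫⁻ x, ENNReal.ofReal |φ n x - c| ∂μ = eLpNorm (fun x => φ n x - c) 1 μ := by
          rw [eLpNorm_one_eq_lintegral_enorm]
          simp only [Real.enorm_eq_ofReal_abs]
      _ ≤ eLpNorm (fun x => φ n x - c) 2 μ :=
          eLpNorm_le_eLpNorm_of_exponent_le (by norm_num)
            ((hφm n).sub_const c).aestronglyMeasurable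
      _ = _ := by
          refine eLpNorm_congr_ae ?_
          filter_upwards [hae, hPc] with x h1 h2
          simp only [Pi.sub_apply, h2]
          exact congrArg (· - c) h1.symm
  -- The constant is found by integrating: by invariance every average with `n ≥ 1` has integral
  -- `μ.real A`.
  suffices h : c = μ.real A by rwa [h] at hL1
  have hind : ∀ k, Integrable (fun x => A.indicator (fun _ => (1 : ℝ)) (f^[k] x)) μ := fun k =>
    ((integrable_const (1 : ℝ)).indicator (hf.measurable.iterate k hA) :
      Integrable ((f^[k] ⁻¹' A).indicator fun _ => (1 : ℝ)) μ)
  have hint : ∀ n, Integrable (φ n) μ := fun n =>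
    (integrable_finsetSum (Finset.range n) fun k _ => hind k).smul (n : ℝ)⁻¹
  have hval : ∀ n, 1 ≤ n → ∫ x, φ n x ∂μ = μ.real A := fun n hn => by
    have hk : ∀ k, ∫ x, A.indicator (fun _ => (1 : ℝ)) (f^[k] x) ∂μ = μ.real A := fun k => by
      have h1 : (fun x => A.indicator (fun _ => (1 : ℝ)) (f^[k] x)) =
        (f^[k] ⁻¹' A).indicator fun _ => (1 : ℝ) := rfl
      rw [h1, integral_indicator_const _ (hf.measurable.iterate k hA), measureReal_def,
        (hf.toMeasurePreserving.iterate k).measure_preimage hA.nullMeasurableSet]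
      simp [measureReal_def]
    simp only [φ, birkhoffAverage, birkhoffSum]
    rw [integral_smul, integral_finsetSum _ fun k _ => hind k]
    simp only [hk, Finset.sum_const, Finset.card_range, nsmul_eq_mul, smul_eq_mul]
    have : (n : ℝ) ≠ 0 := by positivity
    field_simp
  have hle : ∀ᶠ n in atTop, ENNReal.ofReal |μ.real A - c| ≤ ∫⁻ x, ENNReal.ofReal |φ n x - c| ∂μ := by
    filter_upwards [eventually_ge_atTop 1] with n hn
    have hc : μ.real A - c = ∫ x, (φ n x - c) ∂μ := by
      rw [integral_sub (hint n) (integrable_const c), hval n hn]; simp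
    rw [hc, ← Real.enorm_eq_ofReal_abs]
    refine (enorm_integral_le_lintegral_enorm _).trans_eq ?_
    simp only [Real.enorm_eq_ofReal_abs]
  have := ge_of_tendsto hL1 hle
  have h0 : |μ.real A - c| ≤ 0 := ENNReal.ofReal_eq_zero.1 (le_antisymm this zero_le)
  have := abs_eq_zero.1 (le_antisymm h0 (abs_nonneg _))
  linarith

end MeanErgodic

/-! ### Empirical measures -/

section Empirical

variable {X : Type*} [MeasurableSpace X] {f : X → X} {μ : Measure X}

lemma isProbabilityMeasure_empiricalMeasure {n : ℕ} (hn : 1 ≤ n) (x : X) :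
    IsProbabilityMeasure (empiricalMeasure f n x) := by
  refine ⟨?_⟩
  simp only [empiricalMeasure, Measure.smul_apply, Measure.finsetSum_apply, measure_univ,
    Finset.sum_const, Finset.card_range, smul_eq_mul, nsmul_eq_mul, mul_one]
  exact ENNReal.inv_mul_cancel (by simp; omega) (by simp)

lemma empiricalMeasure_real {A : Set X} (hA : MeasurableSet A) (n : ℕ) (x : X) :
    (empiricalMeasure f n x).real A = birkhoffAverage ℝ f (A.indicator fun _ => (1 : ℝ)) n x := by
  simp only [empiricalMeasure, measureReal_def, Measure.smul_apply, Measure.finsetSum_apply,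
    birkhoffAverage, birkhoffSum, smul_eq_mul, ENNReal.toReal_mul, ENNReal.toReal_inv,
    ENNReal.toReal_natCast]
  congr 1
  rw [ENNReal.toReal_sum fun k _ => measure_ne_top _ _]
  refine Finset.sum_congr rfl fun k _ => ?_
  rw [Measure.dirac_apply' _ hA]
  by_cases h : f^[k] x ∈ A <;> simp [h]

lemma measurable_empiricalMeasure_real (hf : Measurable f) {A : Set X} (hA : MeasurableSet A)
    (n : ℕ) : Measurable fun x => (empiricalMeasure f n x).real A := by
  simp only [empiricalMeasure_real hA]
  exact measurable_birkhoffAverage_indicator hf hA n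

lemma measurable_partitionVariation_empiricalMeasure {Y : Type*} (hf : Measurable f)
    (q : SimpleFunc X Y) (μ : Measure X) (n : ℕ) :
    Measurable fun x => partitionVariation q (empiricalMeasure f n x) μ := by
  refine Finset.measurable_sum _ fun y _ => ENNReal.measurable_ofReal.comp ?_
  exact (((measurable_empiricalMeasure_real hf (q.measurableSet_fiber y) n).sub_const _).norm)

lemma tendsto_lintegral_partitionVariation {Y : Type*} [IsProbabilityMeasure μ] (hf : Ergodic f μ)
    (q : SimpleFunc X Y) :
    Tendsto (fun n => ∫⁻ x, partitionVariation q (empiricalMeasure f n x) μ ∂μ) atTop (𝓝 0) := by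
  have h : ∀ n, ∫⁻ x, partitionVariation q (empiricalMeasure f n x) μ ∂μ =
      ∑ y ∈ q.range, ∫⁻ x, ENNReal.ofReal |birkhoffAverage ℝ f
        ((q ⁻¹' {y}).indicator fun _ => (1 : ℝ)) n x - μ.real (q ⁻¹' {y})| ∂μ := fun n => by
    simp only [partitionVariation]
    rw [lintegral_finsetSum]
    · simp only [empiricalMeasure_real (q.measurableSet_fiber _)]
    · exact fun y _ => ENNReal.measurable_ofReal.comp
        (((measurable_empiricalMeasure_real hf.measurable (q.measurableSet_fiber y) n).sub_const
          _).norm)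
  simp only [h]
  simpa using tendsto_finsetSum q.range fun y _ =>
    tendsto_lintegral_abs_birkhoffAverage_sub hf (q.measurableSet_fiber y)

end Empirical

/-! ### Mean distance of the empirical measures to a finite set -/

section Limit

variable {X : Type*} [MetricSpace X] [CompactSpace X] [Nonempty X]
  [MeasurableSpace X] [BorelSpace X] {D : Measure X → Measure X → ℝ≥0∞} {f : X → X}

/-- For an ergodic measure `μ`, the average distance of the empirical measures to a finite set of
measures converges to the distance of `μ` to this set. -/
theorem IsPartitionDist.tendsto_lintegral_iInf (hD : IsPartitionDist D) {μ : Measure X}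
    [IsProbabilityMeasure μ] (hf : Ergodic f μ) {ι : Type*} [Finite ι] [Nonempty ι]
    (m : ι → ProbabilityMeasure X) :
    Tendsto (fun n => ∫⁻ x, ⨅ i, D (empiricalMeasure f n x) (m i) ∂μ) atTop
      (𝓝 (⨅ i, D μ (m i))) := by
  obtain ⟨C, hC, hDC⟩ := hD.bounded
  have hfin : ⨅ i, D μ (m i) ≠ ∞ :=
    ne_top_of_le_ne_top hC ((iInf_le _ (Classical.arbitrary ι)).trans (hDC _ _))
  rw [ENNReal.tendsto_nhds hfin]
  intro η hη
  rcases eq_or_ne η ∞ with rfl | hη'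
  · simp
  obtain ⟨q, K, hK, hq⟩ := hD.exists_le_add_mul (ENNReal.half_pos hη.ne')
    (ENNReal.div_ne_top hη' two_ne_zero)
  have hlim : Tendsto (fun n => K * ∫⁻ x, partitionVariation q (empiricalMeasure f n x) μ ∂μ)
      atTop (𝓝 0) := by
    simpa using ENNReal.Tendsto.const_mul (tendsto_lintegral_partitionVariation hf q) (Or.inr hK)
  filter_upwards [eventually_ge_atTop 1,
    hlim.eventually_le_const (ENNReal.half_pos hη.ne')] with n hn hsmall
  have hprob := fun x => isProbabilityMeasure_empiricalMeasure (f := f) hn x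
  -- Only this error term is shown to be measurable. The integrand with `D` is merely compared with
  -- it, and `lintegral_mono` needs no measurability.
  have hmeas : Measurable fun x => η / 2 + K * partitionVariation q (empiricalMeasure f n x) μ :=
    ((measurable_partitionVariation_empiricalMeasure hf.measurable q μ n).const_mul K).const_add _
  have hbound : ∫⁻ x, (η / 2 + K * partitionVariation q (empiricalMeasure f n x) μ) ∂μ ≤ η := by
    rw [lintegral_add_left measurable_const, lintegral_const_mul _
      (measurable_partitionVariation_empiricalMeasure hf.measurable q μ n)]
    calc _ ≤ η / 2 * 1 + η / 2 := by gcongr; simp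
      _ = η := by rw [mul_one, ENNReal.add_halves]
  rw [Set.mem_Icc, tsub_le_iff_right]
  constructor
  · calc ⨅ i, D μ (m i) = ∫⁻ _, ⨅ i, D μ (m i) ∂μ := by simp
      _ ≤ ∫⁻ x, ((⨅ i, D (empiricalMeasure f n x) (m i)) +
            (η / 2 + K * partitionVariation q (empiricalMeasure f n x) μ)) ∂μ := by
          refine lintegral_mono fun x => ?_
          rw [ENNReal.iInf_add]
          refine le_iInf fun i => (iInf_le _ i).trans ?_
          calc D μ (m i) ≤ D μ (empiricalMeasure f n x) + D (empiricalMeasure f n x) (m i) :=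
                hD.triangle _ _ _
            _ ≤ _ := by
                rw [add_comm, hD.symm μ]
                gcongr
                exact hq _ _
      _ ≤ _ := by
          rw [lintegral_add_right _ hmeas]
          gcongr
  · calc ∫⁻ x, ⨅ i, D (empiricalMeasure f n x) (m i) ∂μ
        ≤ ∫⁻ x, ((⨅ i, D μ (m i)) +
            (η / 2 + K * partitionVariation q (empiricalMeasure f n x) μ)) ∂μ := by
          refine lintegral_mono fun x => ?_
          change _ ≤ (⨅ i, D μ (m i)) + _
          rw [ENNReal.iInf_add]
          refine le_iInf fun i => (iInf_le _ i).trans ?_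
          calc D (empiricalMeasure f n x) (m i)
              ≤ D (empiricalMeasure f n x) μ + D μ (m i) := hD.triangle _ _ _
            _ ≤ _ := by
                rw [add_comm]
                gcongr
                exact hq _ _
      _ ≤ _ := by
          rw [lintegral_add_left measurable_const]
          gcongr
          simp

end Limit

/-! ### Existence of an ergodic measure -/

section Existence

variable {X : Type*} [MetricSpace X] [CompactSpace X] [Nonempty X]
  [MeasurableSpace X] [BorelSpace X] {f : X → X}

open scoped BoundedContinuousFunction

lemma integral_empiricalMeasure (φ : X →ᵇ ℝ) (n : ℕ) (x : X) :
    ∫ y, φ y ∂(empiricalMeasure f n x) = birkhoffAverage ℝ f φ n x := by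
  rw [empiricalMeasure, integral_smul_measure,
    integral_finsetSum_measure fun k _ => integrable_dirac (by simp)]
  simp [birkhoffAverage, birkhoffSum]

/-- The **Krylov-Bogoliubov theorem**. -/
theorem exists_invariant_probabilityMeasure (hf : Continuous f) :
    ∃ μ : ProbabilityMeasure X, (μ : Measure X).map f = μ := by
  obtain ⟨x₀⟩ := ‹Nonempty X›
  let u : ℕ → ProbabilityMeasure X := fun n =>
    ⟨empiricalMeasure f (n + 1) x₀, isProbabilityMeasure_empiricalMeasure (by omega) x₀⟩
  let 𝒰 : Ultrafilter ℕ := Ultrafilter.of atTop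
  have h𝒰 : (𝒰 : Filter ℕ) ≤ atTop := Ultrafilter.of_le _
  obtain ⟨μ, -, hμ⟩ := isCompact_univ.ultrafilter_le_nhds (𝒰.map u) (by simp)
  have hlim : Tendsto u 𝒰 (𝓝 μ) := hμ
  rw [ProbabilityMeasure.tendsto_iff_forall_integral_tendsto] at hlim
  refine ⟨μ, ?_⟩
  have : IsProbabilityMeasure ((μ : Measure X).map f) :=
    Measure.isProbabilityMeasure_map hf.aemeasurable
  refine ext_of_forall_integral_eq_of_IsFiniteMeasure fun φ => ?_
  rw [integral_map hf.aemeasurable φ.continuous.aestronglyMeasurable]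
  have h1 := hlim φ
  have h2 := hlim (φ.compContinuous ⟨f, hf⟩)
  have e : ∀ (ψ : X →ᵇ ℝ) n, ∫ y, ψ y ∂(u n : Measure X) = birkhoffAverage ℝ f ψ (n + 1) x₀ :=
    fun ψ n => integral_empiricalMeasure ψ (n + 1) x₀
  simp only [e] at h1 h2
  have hb : Bornology.IsBounded (Set.range fun n => φ (f^[n] x₀)) :=
    φ.isBounded_range.subset (by rintro _ ⟨n, rfl⟩; exact ⟨_, rfl⟩)
  -- The averages along the orbits of `f x₀` and `x₀` differ by two boundary terms divided by the
  -- length.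
  have h3 := ((tendsto_birkhoffAverage_apply_sub_birkhoffAverage ℝ hb).comp
    (tendsto_add_atTop_nat 1)).mono_left h𝒰
  have h4 := h2.sub h1
  have h5 : ∀ n, birkhoffAverage ℝ f (φ.compContinuous ⟨f, hf⟩) n x₀ =
      birkhoffAverage ℝ f φ n (f x₀) := fun n => by
    simp only [birkhoffAverage, birkhoffSum, BoundedContinuousFunction.compContinuous_apply,
      ContinuousMap.coe_mk, ← Function.iterate_succ_apply' f, ← Function.iterate_succ_apply f]
  simp only [h5] at h4
  have := tendsto_nhds_unique h4 h3
  exact sub_eq_zero.1 this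

lemma lipschitzWith_integral (μ : Measure X) [IsProbabilityMeasure μ] :
    LipschitzWith 1 fun φ : C(X, ℝ) => ∫ x, φ x ∂μ := by
  have hint : ∀ φ : C(X, ℝ), Integrable φ μ := fun φ =>
    (BoundedContinuousFunction.mkOfCompact φ).integrable μ
  refine LipschitzWith.of_dist_le_mul fun φ ψ => ?_
  rw [dist_eq_norm, ← integral_sub (hint φ) (hint ψ)]
  refine (norm_integral_le_of_norm_le_const (C := dist φ ψ) (ae_of_all _ fun x => ?_)).trans ?_
  · rw [← dist_eq_norm]; exact ContinuousMap.dist_apply_le_dist x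
  · simp

lemma continuous_integral_continuousMap (φ : C(X, ℝ)) :
    Continuous fun μ : ProbabilityMeasure X => ∫ x, φ x ∂(μ : Measure X) :=
  ProbabilityMeasure.continuous_integral_boundedContinuousFunction
    (BoundedContinuousFunction.mkOfCompact φ)

lemma abs_integral_le_norm (φ : C(X, ℝ)) (μ : Measure X) [IsProbabilityMeasure μ] :
    |∫ x, φ x ∂μ| ≤ ‖φ‖ := by
  simpa using (lipschitzWith_integral μ).dist_le_mul φ 0

lemma mul_sq_convex_combination {a b u v w : ℝ} (hab : a + b = 1) :
    w * (a * u + b * v) ^ 2 = a * (w * u ^ 2) + b * (w * v ^ 2) - a * b * (w * (u - v) ^ 2) := by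
  obtain rfl : b = 1 - a := by linarith
  ring

/-- A continuous self-map of a nonempty compact metric space has an ergodic probability measure. -/
theorem exists_ergodic_measure (hf : Continuous f) :
    ∃ μ : Measure X, IsProbabilityMeasure μ ∧ Ergodic f μ := by
  let φ : ℕ → C(X, ℝ) := TopologicalSpace.denseSeq C(X, ℝ)
  let w : ℕ → ℝ := fun n => (1 / 2) ^ n / (1 + ‖φ n‖ ^ 2)
  have hw : ∀ n, 0 < w n := fun n => by positivity
  have hbound : ∀ (n : ℕ) (μ : Measure X) [IsProbabilityMeasure μ],
      ‖w n * (∫ x, φ n x ∂μ) ^ 2‖ ≤ (1 / 2) ^ n := fun n μ _ => by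
    have h1 : (∫ x, φ n x ∂μ) ^ 2 ≤ 1 + ‖φ n‖ ^ 2 := by
      have := sq_le_sq' (neg_le_of_abs_le (abs_integral_le_norm (φ n) μ))
        (le_of_abs_le (abs_integral_le_norm (φ n) μ))
      linarith
    rw [Real.norm_of_nonneg (mul_nonneg (hw n).le (sq_nonneg _))]
    calc w n * (∫ x, φ n x ∂μ) ^ 2 ≤ w n * (1 + ‖φ n‖ ^ 2) := by gcongr
      _ = (1 / 2) ^ n := div_mul_cancel₀ _ (by positivity)
  have hsum : ∀ (μ : Measure X) [IsProbabilityMeasure μ],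
      Summable fun n => w n * (∫ x, φ n x ∂μ) ^ 2 := fun μ _ =>
    Summable.of_norm_bounded summable_geometric_two fun n => hbound n μ
  -- A continuous function on probability measures, strictly convex because the `φ n` are dense. Its
  -- maximum on the compact set of invariant measures is attained at an extreme point, that is, at
  -- an ergodic measure.
  let Φ : Measure X → ℝ := fun μ => ∑' n, w n * (∫ x, φ n x ∂μ) ^ 2
  have hΦ : Continuous fun μ : ProbabilityMeasure X => Φ μ :=
    continuous_tsum (fun n => ((continuous_integral_continuousMap (φ n)).pow 2).const_mul _)
      summable_geometric_two fun n μ => hbound n μ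
  let S : Set (ProbabilityMeasure X) := {μ | (μ : Measure X).map f = μ}
  have hSclosed : IsClosed S := by
    have : S = {μ | μ.map hf.aemeasurable = μ} := by
      ext μ
      exact ⟨fun h => Subtype.ext h, fun h => congrArg Subtype.val h⟩
    rw [this]
    exact isClosed_eq (ProbabilityMeasure.continuous_map hf) continuous_id
  obtain ⟨μ, hμS, hμmax⟩ := hSclosed.isCompact.exists_isMaxOn
    (exists_invariant_probabilityMeasure hf) hΦ.continuousOn
  refine ⟨μ, inferInstance, Ergodic.of_mem_extremePoints ?_⟩
  rw [mem_extremePoints_iff_left]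
  refine ⟨⟨⟨hf.measurable, hμS⟩, inferInstance⟩, ?_⟩
  rintro μ₁ ⟨h₁, p₁⟩ μ₂ ⟨h₂, p₂⟩ ⟨a, b, ha, hb, hab, heq⟩
  have hatop : a ≠ ∞ := ne_top_of_le_ne_top ENNReal.one_ne_top (hab ▸ le_self_add)
  have hbtop : b ≠ ∞ := ne_top_of_le_ne_top ENNReal.one_ne_top (hab ▸ le_add_self)
  have ha' : 0 < a.toReal := ENNReal.toReal_pos ha.ne' hatop
  have hb' : 0 < b.toReal := ENNReal.toReal_pos hb.ne' hbtop
  have hab' : a.toReal + b.toReal = 1 := by rw [← ENNReal.toReal_add hatop hbtop, hab]; rfl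
  have hint : ∀ (ψ : C(X, ℝ)) (ν : Measure X) [IsFiniteMeasure ν], Integrable ψ ν := fun ψ ν _ =>
    (BoundedContinuousFunction.mkOfCompact ψ).integrable ν
  have hμ : ∀ ψ : C(X, ℝ), ∫ x, ψ x ∂(μ : Measure X) =
      a.toReal * ∫ x, ψ x ∂μ₁ + b.toReal * ∫ x, ψ x ∂μ₂ := fun ψ => by
    rw [← heq, integral_add_measure ((hint ψ μ₁).smul_measure hatop)
      ((hint ψ μ₂).smul_measure hbtop), integral_smul_measure, integral_smul_measure]
    rfl
  have hmax₁ : Φ μ₁ ≤ Φ μ := hμmax (show (⟨μ₁, p₁⟩ : ProbabilityMeasure X) ∈ S from h₁.map_eq)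
  have hmax₂ : Φ μ₂ ≤ Φ μ := hμmax (show (⟨μ₂, p₂⟩ : ProbabilityMeasure X) ∈ S from h₂.map_eq)
  have heqφ : ∀ n, ∫ x, φ n x ∂μ₁ = ∫ x, φ n x ∂μ₂ := by
    by_contra! hne
    obtain ⟨N, hN⟩ := hne
    have hlt : Φ μ < a.toReal * Φ μ₁ + b.toReal * Φ μ₂ := by
      rw [← tsum_mul_left, ← tsum_mul_left,
        ← ((hsum μ₁).mul_left _).tsum_add ((hsum μ₂).mul_left _)]
      refine Summable.tsum_lt_tsum (i := N) (fun n => ?_) ?_ (hsum μ)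
        (((hsum μ₁).mul_left _).add ((hsum μ₂).mul_left _))
      · rw [hμ, mul_sq_convex_combination hab']
        have := mul_nonneg (mul_nonneg ha'.le hb'.le)
          (mul_nonneg (hw n).le (sq_nonneg (∫ x, φ n x ∂μ₁ - ∫ x, φ n x ∂μ₂)))
        linarith
      · rw [hμ, mul_sq_convex_combination hab']
        have h0 : (∫ x, φ N x ∂μ₁ - ∫ x, φ N x ∂μ₂) ≠ 0 := sub_ne_zero.2 hN
        have := mul_pos (mul_pos ha' hb') (mul_pos (hw N) (pow_pos (abs_pos.2 h0) 2))
        rw [sq_abs] at this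
        linarith
    have := add_le_add (mul_le_mul_of_nonneg_left hmax₁ ha'.le)
      (mul_le_mul_of_nonneg_left hmax₂ hb'.le)
    rw [← add_mul, hab', one_mul] at this
    exact hlt.not_ge this
  have hall : (fun ψ : C(X, ℝ) => ∫ x, ψ x ∂μ₁) = fun ψ => ∫ x, ψ x ∂μ₂ :=
    (TopologicalSpace.denseRange_denseSeq C(X, ℝ)).equalizer
      (lipschitzWith_integral μ₁).continuous (lipschitzWith_integral μ₂).continuous
      (funext heqφ)
  have h12 : μ₁ = μ₂ := ext_of_forall_integral_eq_of_IsFiniteMeasure fun ψ =>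
    congrFun hall ψ.toContinuousMap
  rw [← heq, ← h12, ← add_smul, hab, one_smul]

end Existence

/-! ### The superposed measure -/

section Superposition

variable {X : Type*} [MeasurableSpace X] {f : X → X}

/-- The average of a finite set of measures. -/
noncomputable def averageMeasure (F : Finset (Measure X)) : Measure X :=
  (F.card : ℝ≥0∞)⁻¹ • ∑ ν ∈ F, ν

/-- The combination of the averages of the sets `F k` with the weights `2 ^ (-(k + 1))`. -/
noncomputable def superposition (F : ℕ → Finset (Measure X)) : Measure X :=
  Measure.sum fun k => (2⁻¹ : ℝ≥0∞) ^ (k + 1) • averageMeasure (F k)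

lemma tsum_two_inv_pow_succ : ∑' k : ℕ, (2⁻¹ : ℝ≥0∞) ^ (k + 1) = 1 := by
  rw [ENNReal.tsum_geometric_add_one, ENNReal.one_sub_inv_two, inv_inv]
  exact ENNReal.inv_mul_cancel two_ne_zero ENNReal.ofNat_ne_top

lemma average_le {F : Finset (Measure X)} {c : Measure X → ℝ≥0∞} {C : ℝ≥0∞}
    (h : ∀ ν ∈ F, c ν ≤ C) : (F.card : ℝ≥0∞)⁻¹ * ∑ ν ∈ F, c ν ≤ C := by
  calc (F.card : ℝ≥0∞)⁻¹ * ∑ ν ∈ F, c ν ≤ (F.card : ℝ≥0∞)⁻¹ * (F.card * C) := by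
        gcongr
        simpa using Finset.sum_le_card_nsmul F c C h
    _ = ((F.card : ℝ≥0∞)⁻¹ * F.card) * C := (mul_assoc _ _ _).symm
    _ ≤ 1 * C := by gcongr; exact ENNReal.inv_mul_le_one _
    _ = C := one_mul C

lemma superposition_apply (F : ℕ → Finset (Measure X)) {s : Set X} (hs : MeasurableSet s) :
    superposition F s = ∑' k, (2⁻¹ : ℝ≥0∞) ^ (k + 1) *
      (((F k).card : ℝ≥0∞)⁻¹ * ∑ ν ∈ F k, ν s) := by
  simp [superposition, averageMeasure, Measure.sum_apply _ hs, Measure.finsetSum_apply]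

lemma lintegral_superposition (F : ℕ → Finset (Measure X)) (g : X → ℝ≥0∞) :
    ∫⁻ x, g x ∂(superposition F) = ∑' k, (2⁻¹ : ℝ≥0∞) ^ (k + 1) *
      (((F k).card : ℝ≥0∞)⁻¹ * ∑ ν ∈ F k, ∫⁻ x, g x ∂ν) := by
  simp [superposition, averageMeasure, lintegral_sum_measure, lintegral_finsetSum_measure]

lemma isProbabilityMeasure_superposition {F : ℕ → Finset (Measure X)} (hF : ∀ k, (F k).Nonempty)
    (hp : ∀ k, ∀ ν ∈ F k, IsProbabilityMeasure ν) : IsProbabilityMeasure (superposition F) := by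
  refine ⟨?_⟩
  rw [superposition_apply F MeasurableSet.univ, ← tsum_two_inv_pow_succ]
  refine tsum_congr fun k => ?_
  have h : ∑ ν ∈ F k, ν Set.univ = (F k).card := by
    rw [Finset.sum_congr rfl fun ν hν => (hp k ν hν).measure_univ]; simp
  rw [h, ENNReal.inv_mul_cancel (by simpa using (hF k).ne_empty) (by simp), mul_one]

lemma measurePreserving_superposition {F : ℕ → Finset (Measure X)} (hf : Measurable f)
    (hp : ∀ k, ∀ ν ∈ F k, MeasurePreserving f ν ν) :
    MeasurePreserving f (superposition F) (superposition F) := by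
  refine ⟨hf, ?_⟩
  ext s hs
  rw [Measure.map_apply hf hs, superposition_apply F (hf hs), superposition_apply F hs]
  refine tsum_congr fun k => ?_
  congr 2
  exact Finset.sum_congr rfl fun ν hν => (hp k ν hν).measure_preimage hs.nullMeasurableSet

end Superposition

/-! ### Emergence of the superposed measure -/

section Growth

variable {X : Type*} [MetricSpace X] [CompactSpace X] [Nonempty X]
  [MeasurableSpace X] [BorelSpace X] {D : Measure X → Measure X → ℝ≥0∞} {f : X → X}

lemma IsPartitionDist.tendsto_lintegral_superposition (hD : IsPartitionDist D)
    {F : ℕ → Finset (Measure X)} (hF : ∀ k, (F k : Set (Measure X)) ⊆ ergodicMeasures f)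
    {ι : Type*} [Finite ι] [Nonempty ι] (m : ι → ProbabilityMeasure X) :
    Tendsto (fun n => ∫⁻ x, ⨅ i, D (empiricalMeasure f n x) (m i) ∂(superposition F)) atTop
      (𝓝 (∑' k, (2⁻¹ : ℝ≥0∞) ^ (k + 1) *
        (((F k).card : ℝ≥0∞)⁻¹ * ∑ ν ∈ F k, ⨅ i, D ν (m i)))) := by
  obtain ⟨C, hC, hDC⟩ := hD.bounded
  -- The series over `k` is read as an integral for the counting measure, so that dominated
  -- convergence applies with bound `2 ^ (-(k + 1)) * C`.
  simp only [lintegral_superposition, ← lintegral_count]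
  refine tendsto_lintegral_filter_of_dominated_convergence
    (fun k : ℕ => (2⁻¹ : ℝ≥0∞) ^ (k + 1) * C) (Eventually.of_forall fun n => measurable_of_countable _)
    ?_ ?_ (ae_of_all _ fun k => ?_)
  · filter_upwards [eventually_ge_atTop 1] with n hn
    refine ae_of_all _ fun k => ?_
    gcongr
    refine average_le fun ν hν => ?_
    have : IsProbabilityMeasure ν := (hF k hν).1
    have hprob := fun x => isProbabilityMeasure_empiricalMeasure (f := f) hn x
    calc ∫⁻ x, ⨅ i, D (empiricalMeasure f n x) (m i) ∂ν ≤ ∫⁻ _, C ∂ν :=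
          lintegral_mono fun x => (iInf_le _ (Classical.arbitrary ι)).trans (hDC _ _)
      _ = C := by simp
  · rw [lintegral_count, ENNReal.tsum_mul_right, tsum_two_inv_pow_succ, one_mul]
    exact hC
  · have hcard : (F k).Nonempty → ((F k).card : ℝ≥0∞)⁻¹ ≠ ∞ := fun h => by
      simpa using h.ne_empty
    rcases (F k).eq_empty_or_nonempty with h | h
    · simp [h]
    refine ENNReal.Tendsto.const_mul (ENNReal.Tendsto.const_mul ?_ (Or.inr (hcard h)))
      (Or.inr (ENNReal.pow_ne_top (by simp)))
    refine tendsto_finsetSum _ fun ν hν => ?_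
    have : IsProbabilityMeasure ν := (hF k hν).1
    exact hD.tendsto_lintegral_iInf (hF k hν).2 m

lemma IsPartitionDist.metricEmergenceMap_superposition_le (hD : IsPartitionDist D)
    {F : ℕ → Finset (Measure X)} (hF : ∀ k, (F k : Set (Measure X)) ⊆ ergodicMeasures f)
    {T : Finset (Measure X)} (hT : ∀ ν ∈ T, IsProbabilityMeasure ν) (hne : T.Nonempty) {ε : ℝ}
    (hcov : ∀ k, ∀ ν ∈ F k, ∃ κ ∈ T, D ν κ ≤ ENNReal.ofReal ε) :
    metricEmergenceMap D f (superposition F) ε ≤ T.card := by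
  have : Nonempty (Fin T.card) := ⟨⟨0, hne.card_pos⟩⟩
  let m : Fin T.card → ProbabilityMeasure X := fun i =>
    ⟨(T.equivFin.symm i).1, hT _ (T.equivFin.symm i).2⟩
  refine iInf₂_le T.card ⟨m, ?_⟩
  rw [(hD.tendsto_lintegral_superposition hF m).limsup_eq]
  calc _ ≤ ∑' k : ℕ, (2⁻¹ : ℝ≥0∞) ^ (k + 1) * ENNReal.ofReal ε := by
        refine ENNReal.tsum_le_tsum fun k => ?_
        gcongr
        refine average_le fun ν hν => ?_
        obtain ⟨κ, hκ, hle⟩ := hcov k ν hν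
        refine (iInf_le _ (T.equivFin ⟨κ, hκ⟩)).trans ?_
        simpa [m] using hle
    _ = ENNReal.ofReal ε := by rw [ENNReal.tsum_mul_right, tsum_two_inv_pow_succ, one_mul]

/-- Half of the points of a separated set are far from any given small set. -/
lemma IsPartitionDist.le_sum_iInf (hD : IsPartitionDist D) {F : Finset (Measure X)}
    (hF : ∀ ν ∈ F, IsProbabilityMeasure ν) {r : ℝ} (hsep : IsSep D F r) {N : ℕ}
    (hN : 2 * N < F.card) (m : Fin N → ProbabilityMeasure X) :
    ENNReal.ofReal (F.card * (r / 4)) ≤ ∑ ν ∈ F, ⨅ i, D ν (m i) := by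
  classical
  rcases le_or_gt r 0 with hr | hr
  · rw [ENNReal.ofReal_of_nonpos (mul_nonpos_of_nonneg_of_nonpos (Nat.cast_nonneg _)
      (by linarith))]
    exact zero_le
  let good := F.filter fun ν => ENNReal.ofReal (r / 2) ≤ ⨅ i, D ν (m i)
  let bad := F.filter fun ν => ¬ ENNReal.ofReal (r / 2) ≤ ⨅ i, D ν (m i)
  have hbad : ∀ ν ∈ bad, ∃ i, D ν (m i) < ENNReal.ofReal (r / 2) := fun ν hν =>
    iInf_lt_iff.1 (not_le.1 (Finset.mem_filter.1 hν).2)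
  choose g hg using hbad
  -- Two points within `r / 2` of the same `m i` would be closer than `r`.
  have hNbad : bad.card ≤ N := by
    rw [← Fintype.card_coe, ← Fintype.card_fin N]
    refine Fintype.card_le_of_injective (fun ν : bad => g ν.1 ν.2) fun ν κ hνκ => ?_
    by_contra hne
    have hν := (Finset.mem_filter.1 ν.2).1
    have hκ := (Finset.mem_filter.1 κ.2).1
    have := hF _ hν
    have := hF _ hκ
    refine (hsep hν hκ fun h => hne (Subtype.ext h)).not_gt ?_
    have h2 := hg κ.1 κ.2
    rw [← show g ν.1 ν.2 = g κ.1 κ.2 from hνκ] at h2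
    calc D ν κ ≤ D ν (m (g ν.1 ν.2)) + D (m (g ν.1 ν.2)) κ := hD.triangle _ _ _
      _ < ENNReal.ofReal (r / 2) + ENNReal.ofReal (r / 2) := by
          rw [hD.symm _ κ.1]
          exact ENNReal.add_lt_add (hg ν.1 ν.2) h2
      _ = ENNReal.ofReal r := by
          rw [← ENNReal.ofReal_add (by positivity) (by positivity), add_halves]
  have hcard : good.card + bad.card = F.card := Finset.card_filter_add_card_filter_not _
  have hgood : (F.card : ℝ) ≤ 2 * good.card := by
    have : F.card ≤ 2 * good.card := by omega
    exact_mod_cast this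
  calc ENNReal.ofReal (F.card * (r / 4)) ≤ ENNReal.ofReal (good.card * (r / 2)) := by
        refine ENNReal.ofReal_le_ofReal ?_
        nlinarith
    _ = ∑ ν ∈ good, ENNReal.ofReal (r / 2) := by
        rw [Finset.sum_const, nsmul_eq_mul, ENNReal.ofReal_mul (Nat.cast_nonneg _),
          ENNReal.ofReal_natCast]
    _ ≤ ∑ ν ∈ good, ⨅ i, D ν (m i) :=
        Finset.sum_le_sum fun ν hν => (Finset.mem_filter.1 hν).2
    _ ≤ _ := Finset.sum_le_sum_of_subset (Finset.filter_subset _ _)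

/-- With fewer than half as many measures as points, the level `k` alone costs `2 ^ (-(k + 1)) * (r
/ 4) = 2 ^ (-(k + 3)) * r`, twice the allowed error. -/
lemma IsPartitionDist.card_le_metricEmergenceMap (hD : IsPartitionDist D)
    {F : ℕ → Finset (Measure X)} (hF : ∀ k, (F k : Set (Measure X)) ⊆ ergodicMeasures f) {k : ℕ}
    {r : ℝ} (hr : 0 < r) (hsep : IsSep D (F k) r) :
    (((F k).card : ℕ) : ℕ∞) ≤
      2 * metricEmergenceMap D f (superposition F) ((1 / 2) ^ (k + 4) * r) := by
  have key : ((((F k).card + 1) / 2 : ℕ) : ℕ∞) ≤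
      metricEmergenceMap D f (superposition F) ((1 / 2) ^ (k + 4) * r) := by
    refine le_iInf₂ fun N ⟨m, hm⟩ => ?_
    suffices h : (F k).card ≤ 2 * N by
      have : ((F k).card + 1) / 2 ≤ N := by omega
      exact_mod_cast this
    by_contra! hN
    have hpos : 0 < (F k).card := by omega
    have hne : Nonempty (Fin N) := by
      by_contra hempty
      rw [not_nonempty_iff] at hempty
      have huniv : superposition F Set.univ ≠ 0 := by
        rw [superposition_apply F MeasurableSet.univ]
        intro h0
        have h1 := ENNReal.tsum_eq_zero.1 h0 k
        have h2 : ∑ ν ∈ F k, ν Set.univ = (F k).card := by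
          rw [Finset.sum_congr rfl fun ν hν => (hF k hν).1.measure_univ]; simp
        rw [h2, ENNReal.inv_mul_cancel (by simpa using hpos.ne') (by simp)] at h1
        simp at h1
      simp only [iInf_of_empty, lintegral_const, ENNReal.top_mul huniv, limsup_const] at hm
      exact ENNReal.ofReal_ne_top (top_le_iff.1 hm)
    rw [(hD.tendsto_lintegral_superposition hF m).limsup_eq] at hm
    have h1 := (ENNReal.le_tsum k).trans hm
    have h2 := hD.le_sum_iInf (fun ν hν => (hF k hν).1) hsep hN m
    have h3 : ENNReal.ofReal ((1 / 2) ^ (k + 1) * (((F k).card : ℝ)⁻¹ * ((F k).card * (r / 4)))) ≤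
        ENNReal.ofReal ((1 / 2) ^ (k + 4) * r) := by
      refine le_trans ?_ h1
      have hc : (0 : ℝ) < (F k).card := by exact_mod_cast hpos
      rw [ENNReal.ofReal_mul (by positivity), ENNReal.ofReal_mul (by positivity),
        ENNReal.ofReal_pow (by positivity), ENNReal.ofReal_inv_of_pos hc, ENNReal.ofReal_natCast,
        one_div, ENNReal.ofReal_inv_of_pos two_pos, ENNReal.ofReal_ofNat]
      gcongr
    rw [ENNReal.ofReal_le_ofReal_iff (by positivity)] at h3
    have hc : ((F k).card : ℝ) ≠ 0 := by exact_mod_cast hpos.ne'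
    rw [inv_mul_cancel_left₀ hc, pow_add, pow_add _ k 4] at h3
    have hp : 0 < (1 / 2 : ℝ) ^ k * r := by positivity
    nlinarith
  calc (((F k).card : ℕ) : ℕ∞) ≤ ((2 * (((F k).card + 1) / 2) : ℕ) : ℕ∞) := by
        exact_mod_cast (by omega : (F k).card ≤ 2 * (((F k).card + 1) / 2))
    _ = 2 * ((((F k).card + 1) / 2 : ℕ) : ℕ∞) := by push_cast; rfl
    _ ≤ _ := by gcongr

/-- This absorbs the loss from the weight. With `P = 2 ^ (k + 4)`, the bound `r ≤ P ^ (-(k + 1))`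
makes the gain `r ^ (-(b' - c))` at least `P ^ (c + 1)`: the factor `P ^ c` pays for the rescaling
of `r`, and the remaining `P` for the division by `2`. -/
lemma exp_rpow_le_half_exp {k : ℕ} {r b b' c : ℝ} (hr : 0 < r)
    (hrk : r ≤ (1 / 2) ^ ((k + 4) * (k + 1))) (hc : 0 ≤ c) (hcb : c ≤ b') (hb : b' ≤ b)
    (hk : c + 1 ≤ (k + 1) * (b' - c)) :
    Real.exp (((1 / 2) ^ (k + 4) * r) ^ (-c)) ≤ Real.exp (r ^ (-b)) / 2 := by
  have hr1 : r ≤ 1 := hrk.trans (pow_le_one₀ (by norm_num) (by norm_num))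
  set P : ℝ := 2 ^ (k + 4) with hP
  have hP2 : 2 ≤ P := by
    calc (2 : ℝ) = 2 ^ 1 := (pow_one _).symm
      _ ≤ 2 ^ (k + 4) := pow_le_pow_right₀ (by norm_num) (by omega)
  have hP0 : 0 < P := by linarith
  have e1 : ((1 / 2) ^ (k + 4) * r) ^ (-c) = P ^ c * r ^ (-c) := by
    rw [Real.mul_rpow (by positivity) hr.le, one_div, inv_pow, ← hP, Real.inv_rpow hP0.le,
      Real.rpow_neg hP0.le, inv_inv]
  have h1 : P ^ (c + 1) ≤ r ^ (-(b' - c)) := by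
    calc P ^ (c + 1) ≤ P ^ ((k + 1) * (b' - c)) :=
          Real.rpow_le_rpow_of_exponent_le (by linarith) hk
      _ = ((1 / 2) ^ ((k + 4) * (k + 1))) ^ (-(b' - c)) := by
          rw [one_div, inv_pow, Real.inv_rpow (by positivity), Real.rpow_neg (by positivity),
            inv_inv, pow_mul, ← hP, Real.rpow_mul hP0.le]
          congr 1
          exact_mod_cast Real.rpow_natCast P (k + 1)
      _ ≤ r ^ (-(b' - c)) :=
          Real.rpow_le_rpow_of_nonpos hr hrk (by linarith)
  have h2 : 1 ≤ P ^ c := Real.one_le_rpow (by linarith) hc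
  have h3 : 1 ≤ r ^ (-c) := Real.one_le_rpow_of_pos_of_le_one_of_nonpos hr hr1 (by linarith)
  have h4 : P ^ (c + 1) = P ^ c * P := by rw [Real.rpow_add hP0, Real.rpow_one]
  have h5 : r ^ (-b') = r ^ (-c) * r ^ (-(b' - c)) := by
    rw [← Real.rpow_add hr]; congr 1; ring
  have h6 : P ^ c * r ^ (-c) + 1 ≤ r ^ (-b) := by
    calc P ^ c * r ^ (-c) + 1 ≤ r ^ (-c) * (P ^ c * P) := by
          have h6 : 1 ≤ P ^ c * r ^ (-c) := one_le_mul_of_one_le_of_one_le h2 h3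
          nlinarith
      _ ≤ r ^ (-c) * r ^ (-(b' - c)) := by rw [← h4]; gcongr
      _ = r ^ (-b') := h5.symm
      _ ≤ r ^ (-b) := rpow_neg_le_rpow_neg hr hr1 hb
  rw [e1, le_div_iff₀ two_pos]
  calc Real.exp (P ^ c * r ^ (-c)) * 2 ≤ Real.exp (P ^ c * r ^ (-c)) * Real.exp 1 := by
        gcongr
        linarith [Real.add_one_le_exp 1]
    _ = Real.exp (P ^ c * r ^ (-c) + 1) := (Real.exp_add _ _).symm
    _ ≤ Real.exp (r ^ (-b)) := Real.exp_le_exp.2 h6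

lemma IsPartitionDist.le_metricEmergence_superposition (hD : IsPartitionDist D)
    {F : ℕ → Finset (Measure X)} (hF : ∀ k, (F k : Set (Measure X)) ⊆ ergodicMeasures f)
    {r b : ℕ → ℝ} {β : EReal} (hβ : 0 < β)
    (hb : Tendsto (fun n => (b n : EReal)) atTop (𝓝 β)) (hr : ∀ n, 0 < r n)
    (hrs : ∀ n, r n ≤ (1 / 2) ^ ((n + 4) * (n + 1))) (hsep : ∀ n, IsSep D (F n) (r n))
    (hcard : ∀ n, Real.exp (r n ^ (-b n)) < (F n).card) :
    β ≤ metricEmergence D f (superposition F) := by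
  refine EReal.ge_of_forall_gt_iff_ge.1 fun c₀ hc₀ => ?_
  obtain ⟨c, hc, hcβ⟩ := EReal.lt_iff_exists_real_btwn.1 (max_lt hc₀ hβ)
  have hc0 : 0 ≤ c := by exact_mod_cast ((le_max_right _ _).trans_lt hc).le
  refine ((le_max_left _ _).trans_lt hc).le.trans ?_
  obtain ⟨b', hcb', hb'β⟩ := EReal.lt_iff_exists_real_btwn.1 hcβ
  have hcb : c < b' := by exact_mod_cast hcb'
  let e : ℕ → ℝ := fun k => (1 / 2) ^ (k + 4) * r k
  have he0 : ∀ k, 0 < e k := fun k => mul_pos (by positivity) (hr k)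
  have hr1 : ∀ k, r k ≤ 1 := fun k => (hrs k).trans (pow_le_one₀ (by norm_num) (by norm_num))
  have helt : ∀ k, e k ≤ (1 / 2) ^ (k + 4) := fun k =>
    mul_le_of_le_one_right (by positivity) (hr1 k)
  have hlim : Tendsto e atTop (𝓝[>] 0) := by
    refine tendsto_nhdsWithin_iff.2 ⟨?_, Eventually.of_forall he0⟩
    have h0 : Tendsto (fun k : ℕ => (1 / 2 : ℝ) ^ (k + 4)) atTop (𝓝 0) :=
      (tendsto_pow_atTop_nhds_zero_of_lt_one (by norm_num) (by norm_num)).comp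
        (tendsto_add_atTop_nat 4)
    exact squeeze_zero (fun k => (he0 k).le) helt h0
  have hk : ∀ᶠ k : ℕ in atTop, c + 1 ≤ (k + 1) * (b' - c) := by
    have : Tendsto (fun k : ℕ => ((k : ℝ) + 1) * (b' - c)) atTop atTop :=
      (tendsto_atTop_add_const_right _ _ tendsto_natCast_atTop_atTop).atTop_mul_const
        (sub_pos.2 hcb)
    exact this.eventually_ge_atTop _
  -- A limsup is bounded below along one sequence of scales, here `e k`; nothing is needed between
  -- them.
  refine le_limsup_of_frequently_le (hlim.frequently (Eventually.frequently ?_))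
    (by isBoundedDefault)
  filter_upwards [hk, hb.eventually_const_lt hb'β] with k hk hbk
  have hbk' : b' < b k := by exact_mod_cast hbk
  have he1 : e k < 1 := (helt k).trans_lt (pow_lt_one₀ (by norm_num) (by norm_num) (by omega))
  refine le_logLog_div (he0 k) he1 fun n hn => ?_
  have h1 := hD.card_le_metricEmergenceMap hF (hr k) (hsep k)
  rw [hn] at h1
  have h2 : ((F k).card : ℝ) ≤ 2 * n := by exact_mod_cast h1
  have h3 := exp_rpow_le_half_exp (hr k) (hrs k) hc0 hcb.le hbk'.le hk
  have h4 := hcard k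
  change Real.exp (e k ^ (-c)) ≤ _ at h3
  linarith

lemma IsPartitionDist.metricEmergence_superposition_le (hD : IsPartitionDist D)
    {F : ℕ → Finset (Measure X)} (hF : ∀ k, (F k : Set (Measure X)) ⊆ ergodicMeasures f)
    (hne : ∀ k, (F k).Nonempty) {b : ℕ → ℝ} {B : ℝ} (hB : 0 ≤ B) (hb : ∀ n, b n ≤ B)
    {s : ℕ → ℝ} (hs : ∀ n, s n ≤ (1 / 2) ^ n)
    (hclose : ∀ m n, m ≤ n → ∀ x ∈ F m, ∀ y ∈ F n, D x y ≤ ENNReal.ofReal (s m))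
    (hcov : ∀ n, ∀ ε : ℝ, 0 < ε → ∃ T ⊆ F n, (T.card : ℝ) ≤ Real.exp (ε ^ (-b n)) + 1 ∧
      ∀ x ∈ F n, ∃ y ∈ T, D x y ≤ ENNReal.ofReal ε) :
    metricEmergence D f (superposition F) ≤ B := by
  classical
  refine EReal.le_of_forall_lt_iff_le.1 fun c hc => ?_
  have hBc : B < c := by exact_mod_cast hc
  refine limsup_le_of_le (by isBoundedDefault) ?_
  filter_upwards [eventually_lt_one, eventually_mul_exp_rpow_le hB hBc] with ε ⟨hε0, hε1⟩ hexp
  choose T hTF hTcard hT using fun n => hcov n ε hε0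
  -- Then `s K ≤ 2 ^ (-K) ≤ ε`, so a single point `y₀` of `F K` covers all `F k` with `k ≥ K`; the
  -- earlier sets use their own nets.
  let K := ⌈1 / ε⌉₊
  obtain ⟨y₀, hy₀⟩ := hne K
  let T' := insert y₀ ((Finset.range K).biUnion T)
  have hle : metricEmergenceMap D f (superposition F) ε ≤ T'.card := by
    refine hD.metricEmergenceMap_superposition_le hF (fun ν hν => ?_) ⟨y₀, by simp [T']⟩
      fun k ν hν => ?_
    · rcases Finset.mem_insert.1 hν with rfl | hν
      · exact (hF K hy₀).1
      · obtain ⟨k, -, hν⟩ := Finset.mem_biUnion.1 hν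
        exact (hF k (hTF k hν)).1
    · rcases lt_or_ge k K with hk | hk
      · obtain ⟨y, hy, hd⟩ := hT k ν hν
        exact ⟨y, Finset.mem_insert_of_mem
          (Finset.mem_biUnion.2 ⟨k, Finset.mem_range.2 hk, hy⟩), hd⟩
      · refine ⟨y₀, Finset.mem_insert_self _ _, ?_⟩
        rw [hD.symm]
        refine (hclose K k hk y₀ hy₀ ν hν).trans (ENNReal.ofReal_le_ofReal ((hs K).trans ?_))
        have h1 : 1 / ε ≤ 2 ^ K :=
          (Nat.le_ceil _).trans (by exact_mod_cast (Nat.lt_two_pow_self (n := K)).le)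
        rw [one_div, inv_pow]
        rw [one_div] at h1
        exact inv_le_of_inv_le₀ hε0 h1
  have hcard : (T'.card : ℝ) ≤ Real.exp (ε ^ (-c)) := by
    refine le_trans ?_ hexp
    have h1 : T'.card ≤ (∑ k ∈ Finset.range K, (T k).card) + 1 :=
      (Finset.card_insert_le _ _).trans (Nat.add_le_add_right Finset.card_biUnion_le 1)
    have h2 : ∀ k ∈ Finset.range K, ((T k).card : ℝ) ≤ Real.exp (ε ^ (-B)) + 1 := fun k _ =>
      (hTcard k).trans (add_le_add_left
        (Real.exp_le_exp.2 (rpow_neg_le_rpow_neg hε0 hε1.le (hb k))) 1)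
    have h3 : ((∑ k ∈ Finset.range K, (T k).card : ℕ) : ℝ) ≤ K * (Real.exp (ε ^ (-B)) + 1) := by
      push_cast
      refine (Finset.sum_le_card_nsmul _ _ _ h2).trans_eq ?_
      rw [Finset.card_range, nsmul_eq_mul]
    have h4 : (K : ℝ) ≤ 1 / ε + 2 := by
      have := Nat.ceil_lt_add_one (a := 1 / ε) (by positivity)
      linarith
    have h5 : (T'.card : ℝ) ≤ ((∑ k ∈ Finset.range K, (T k).card : ℕ) : ℝ) + 1 := by
      exact_mod_cast h1
    calc (T'.card : ℝ) ≤ 1 + K * (Real.exp (ε ^ (-B)) + 1) := by linarith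
      _ ≤ _ := by gcongr
  obtain ⟨n, hn⟩ := ENat.ne_top_iff_exists.1 (ne_top_of_le_ne_top (ENat.natCast_ne_top _) hle)
  rw [← hn] at hle ⊢
  refine logLog_div_le hε0 hε1 (by linarith) (le_trans ?_ hcard)
  exact_mod_cast hle

lemma IsPartitionDist.metricEmergence_eq_zero (hD : IsPartitionDist D) {μ : Measure X}
    [IsProbabilityMeasure μ] (hf : Ergodic f μ) : metricEmergence D f μ = 0 := by
  have key : ∀ ε : ℝ, metricEmergenceMap D f μ ε ≤ 1 := fun ε => by
    let m : Fin 1 → ProbabilityMeasure X := fun _ => ⟨μ, inferInstance⟩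
    refine iInf₂_le_of_le 1 ⟨m, ?_⟩ (by simp)
    rw [(hD.tendsto_lintegral_iInf hf m).limsup_eq]
    simp [m, hD.self_eq_zero μ]
  have hzero : ∀ ε : ℝ, logLog (metricEmergenceMap D f μ ε) = 0 := fun ε => by
    obtain ⟨n, hn⟩ := ENat.ne_top_iff_exists.1 (ne_top_of_le_ne_top ENat.one_ne_top (key ε))
    have h1 : n ≤ 1 := by
      have := key ε
      rw [← hn] at this
      exact_mod_cast this
    rw [← hn]
    change ((Real.log (Real.log n) : ℝ) : EReal) = 0
    interval_cases n <;> simp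
  simp [metricEmergence, upperOrder, hzero]

end Growth
end Emergence

/-- Every value between zero and the topological emergence is the metric emergence of an invariant
probability measure. -/
theorem theoremC {X : Type*} [MetricSpace X] [CompactSpace X] [Nonempty X]
    [MeasurableSpace X] [BorelSpace X]
    (D : Measure X → Measure X → ℝ≥0∞) (hD : Emergence.IsWassersteinOrLevyProkhorov D)
    (f : X → X) (hf : Continuous f)
    (β : EReal) (hβ₀ : 0 ≤ β) (hβ : β ≤ Emergence.topologicalEmergence D f) :
    ∃ μ : Measure X, IsProbabilityMeasure μ ∧ MeasurePreserving f μ μ ∧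
      Emergence.metricEmergence D f μ = β := by
  have hD' := hD.isPartitionDist
  rcases hβ₀.eq_or_lt with rfl | hpos
  · obtain ⟨μ, hμ, herg⟩ := Emergence.exists_ergodic_measure hf
    exact ⟨μ, hμ, herg.toMeasurePreserving, hD'.metricEmergence_eq_zero herg⟩
  have hprob : ∀ μ ∈ Emergence.ergodicMeasures f, IsProbabilityMeasure μ := fun μ hμ => hμ.1
  obtain ⟨F, r, b, hb, hclose, hF⟩ := Emergence.exists_separated_sequence hpos
    (hD'.isFinitelyCovered hprob)
    (fun μ hμ => by have := hprob μ hμ; exact hD'.self_eq_zero μ)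
    -- The same scale bounds the diameters and, through them, the `r n`. It is the power `n + 1` of
    -- the loss `2 ^ (-(n + 4))`, which makes that loss negligible for every exponent.
    (fun μ _ ν _ => hD'.symm μ ν) hβ (fun n => (1 / 2) ^ ((n + 4) * (n + 1)))
    (fun n => by positivity)
  have hE : ∀ k, (F k : Set (Measure X)) ⊆ Emergence.ergodicMeasures f := fun k => (hF k).1
  have hne : ∀ k, (F k).Nonempty := fun k => by
    rw [← Finset.card_pos]
    exact_mod_cast (Real.exp_pos _).trans (hF k).2.2.2.2.1
  refine ⟨Emergence.superposition F,
    Emergence.isProbabilityMeasure_superposition hne fun k ν hν => (hE k hν).1,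
    Emergence.measurePreserving_superposition hf.measurable
      fun k ν hν => (hE k hν).2.toMeasurePreserving, le_antisymm ?_ ?_⟩
  · induction β with
    | bot => simp at hpos
    | top => exact le_top
    | coe B =>
      refine hD'.metricEmergence_superposition_le hE hne (by exact_mod_cast hβ₀)
        (fun n => by exact_mod_cast (hF n).2.2.2.2.2.1.le)
        (s := fun n => (1 / 2) ^ ((n + 4) * (n + 1))) (fun n => ?_) hclose
        fun n => (hF n).2.2.2.2.2.2
      exact pow_le_pow_of_le_one (by norm_num) (by norm_num) (by nlinarith)
  · exact hD'.le_metricEmergence_superposition hE hpos hb (fun n => (hF n).2.1)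
      (fun n => (hF n).2.2.1) (fun n => (hF n).2.2.2.1) fun n => (hF n).2.2.2.2.1
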